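/- **Theorem (fast-changing and sparse, no mixing).** *Model.* Given $p,q\in[0,1]$, an edge-Markovian dynamic graph $\mathcal G(n,p,q)$ is a Markov chain $(G_t)_{t\in\mathbb N}$ of graphs $G_t=(V,E_t)$ on $V=\{1,\dots,n\}$ in which, at each step and independently over all pairs of distinct vertices, a present edge disappears with probability $q$ and an absent edge appears with probability $p$. The initial graph $G_0$ has an arbitrary distribution. *Walk.* $P_t$ is the transition matrix of the lazy random walk on $G_t$: $P_t(u,u)=\tfrac12$ and $P_t(u,v)=\frac1{2\deg_t(u)}$ for $\{u,v\}\in E_t$ if $\deg_t(u)\ge1$, and $P_t(u,u)=1$ if $u$ is isolated in $G_t$. Let $\mu_t^x=\delta_xP_1P_2\cdots P_t$ be the distribution after $t$ steps of the walk started at $x$, let $\pi_t(v)=\deg_t(v)/(2|E_t|)$ (with $\pi_t=0$ if $E_t=\emptyset$), and $\|f-g\|_{TV}=\frac12\sum_{v}|f(v)-g(v)|$. *Mixing time.* For $\varepsilon\in\mathbb R$ the graph sequence is *$\varepsilon$-mixed from time $t$ on* if $\|\mu_s^x-\pi_s\|_{TV}\le\varepsilon$ for all integers $t\le s\le t+\sqrt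 n$ and all $x\in V$. For $\eta\in\mathbb R$, let $t_{\mathrm{mix}}(\mathcal G(n,p,q))=t_{\mathrm{mix}}^{\varepsilon,\eta}(\mathcal G(n,p,q))\in\mathbb N\cup\{\infty\}$ be the least $t$ such that $$\Pr\big[(G_s)_s\text{ is }\varepsilon\text{-mixed from time }t\text{ on}\big]\ \ge\ 1-\eta ,$$ and $\infty$ if there is no such $t$. Let $\tilde t_{\mathrm{mix}}^{\varepsilon,\eta}(\mathcal G(n,p,q))$ be the variant in which the time may depend on the sampled sequence: the least $t$ such that, with probability at least $1-\eta$, there is a $t'\le t$ from which the sampled sequence is $\varepsilon$-mixed. *Statement.* Let $p=p_n\in[0,1]$ and $q=q_n\in[0,1]$ with $p=\Theta(1/n)$ and $q=\Omega(1)$ as $n\to\infty$. Then: 1. $t_{\mathrm{mix}}(\mathcal G(n,p,q))=\infty$. That is, for all sequences $\varepsilon_n\to0$ and $\eta_n\to0$ one has $t_{\mathrm{mix}}^{\varepsilon_n,\eta_n}(\mathcal G(n,p,q))=\infty$ for all sufficiently large $n$. 2. For all sequences $\varepsilon_n\to0$ and $\eta_n\to0$ and every $k\in\mathbb N$, $\tilde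 t_{\mathrm{mix}}^{\varepsilon_n,\eta_n}(\mathcal G(n,p,q))>n^k$ for all sufficiently large $n$. 3. If $G_0$ is an Erdős–Rényi graph $\mathcal G(n,\frac{p}{p+q})$ for every $n$, then there are constants $\delta,c>0$ such that, for all sufficiently large $n$, every $t\in\mathbb N$ and every $x\in V$, $\Pr\big[\|\mu_t^x-\pi_t\|_{TV}\ge\delta\big]\ge c$. -/

import Mathlib

open Filter Topology Asymptotics MeasureTheory ProbabilityTheory

/-- Transition matrix of the lazy random walk on `g`: stay put with probability `1/2`, otherwise
move to a uniformly random neighbour. The walk stays put at an isolated vertex. -/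
noncomputable def lazyWalk {V : Type*} [Fintype V] (g : SimpleGraph V) : Matrix V V ℝ :=
  open Classical in
  fun u v =>
    if g.degree u = 0 then (if u = v then 1 else 0)
    else if u = v then 1 / 2
    else if g.Adj u v then 1 / (2 * (g.degree u : ℝ))
    else 0

/-- The distribution `μ_t^x` after `t` steps of the walk started at `x`:
`μ_t^x = μ_0^x P_1 P_2 ⋯ P_t`, where `P_s` is the lazy walk matrix of the graph at time `s`. -/
noncomputable def walkDist {V : Type*} [Fintype V] (g : ℕ → SimpleGraph V) (x : V) : ℕ → V → ℝ
  | 0 => open Classical in Pi.single x 1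
  | t + 1 => Matrix.vecMul (walkDist g x t) (lazyWalk (g (t + 1)))

/-- The canonical stationary distribution `deg(v) / (2|E|)` of the lazy walk on `g`. -/
noncomputable def statDist {V : Type*} [Fintype V] (g : SimpleGraph V) (v : V) : ℝ :=
  open Classical in (g.degree v : ℝ) / (2 * (g.edgeFinset.card : ℝ))

/-- Total variation distance. -/
noncomputable def tvDist {V : Type*} [Fintype V] (f g : V → ℝ) : ℝ :=
  1 / 2 * ∑ x, |f x - g x|

/-- The walk on the graph sequence `g` is `ε`-mixed from time `t` on: at every time `s` with
`t ≤ s ≤ t + √n`, and for every starting vertex, its distribution is `ε`-close to `π_s`. -/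
def IsMixedFrom {V : Type*} [Fintype V] (ε : ℝ) (g : ℕ → SimpleGraph V) (t : ℕ) : Prop :=
  ∀ s : ℕ, t ≤ s → (s : ℝ) ≤ (t : ℝ) + Real.sqrt (Fintype.card V) →
    ∀ x : V, tvDist (walkDist g x s) (statDist (g s)) ≤ ε

/-- Mixing time of a dynamic graph sequence with accuracy `ε`: the least `t` from which the walk
is `ε`-mixed, and `⊤` if there is none. -/
noncomputable def seqMixingTime {V : Type*} [Fintype V] (ε : ℝ) (g : ℕ → SimpleGraph V) : ℕ∞ :=
  ⨅ (t : ℕ) (_ : IsMixedFrom ε g t), (t : ℕ∞)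

/-- Probability that the edge-Markovian chain moves from the graph `g` to the graph `h` in one
step: independently over all pairs of distinct vertices, an edge disappears with probability `q`
and a non-edge becomes an edge with probability `p`. -/
noncomputable def edgeTransProb {V : Type*} [Fintype V] (p q : ℝ) (g h : SimpleGraph V) : ℝ :=
  open Classical in
  ∏ e ∈ (⊤ : SimpleGraph V).edgeFinset,
    if e ∈ g.edgeSet then (if e ∈ h.edgeSet then 1 - q else q)
    else (if e ∈ h.edgeSet then p else 1 - p)

/-- The random graph sequence `G` is an edge-Markovian dynamic graph with birth probability `p`
and death probability `q` (a Markov chain with the transition probabilities `edgeTransProb p q`).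
The law of the initial graph `G 0` is unrestricted. -/
structure IsEdgeMarkovian {V : Type*} [Fintype V] {Ω : Type*} [MeasurableSpace Ω]
    (P : Measure Ω) (G : ℕ → Ω → SimpleGraph V) (p q : ℝ) : Prop where
  measurable : ∀ t : ℕ, Measurable (G t)
  transition : ∀ (t : ℕ) (g : ℕ → SimpleGraph V),
    P.real {ω | ∀ i ≤ t + 1, G i ω = g i} =
      P.real {ω | ∀ i ≤ t, G i ω = g i} * edgeTransProb p q (g t) (g (t + 1))

/-- Edge probability `p / (p + q)` of the stationary Erdős–Rényi graph, as an element of `[0, 1]`.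
For `p, q ≥ 0` the fraction lies in `[0, 1]`, so the projection does not change it. -/
noncomputable def stationaryEdgeProb (p q : ℝ) : unitInterval :=
  Set.projIcc (0 : ℝ) 1 zero_le_one (p / (p + q))

/-- Mixing time of a random dynamic graph with accuracy `ε` and failure probability `η`: the least
`t` such that, with probability at least `1 - η`, the walk on the sampled graph sequence is
`ε`-mixed from time `t` on; it is `⊤` if there is no such `t`. -/
noncomputable def modelMixingTime {V : Type*} [Fintype V] {Ω : Type*} [MeasurableSpace Ω]
    (P : Measure Ω) (G : ℕ → Ω → SimpleGraph V) (ε η : ℝ) : ℕ∞ :=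
  ⨅ (t : ℕ) (_ : 1 - η ≤ P.real {ω | IsMixedFrom ε (fun s => G s ω) t}), (t : ℕ∞)

/-- The variant in which the time from which the walk is mixed may depend on the sampled graph
sequence: the least `t` such that, with probability at least `1 - η`, the mixing time of the
sampled graph sequence is at most `t`; it is `⊤` if there is no such `t`. -/
noncomputable def modelHittingMixingTime {V : Type*} [Fintype V] {Ω : Type*} [MeasurableSpace Ω]
    (P : Measure Ω) (G : ℕ → Ω → SimpleGraph V) (ε η : ℝ) : ℕ∞ :=
  ⨅ (t : ℕ) (_ : 1 - η ≤ P.real {ω | seqMixingTime ε (fun s => G s ω) ≤ (t : ℕ∞)}), (t : ℕ∞)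

/-!
The proof rests on a statement about a single step. Let `g` be a graph on `n` vertices in which the
sum of the squared degrees (`degSq g`) is `O(n)`, let `μ` be any probability distribution on the
vertices, and let `h` be the next graph of the chain. Then, with probability bounded below, the
distribution `μ * lazyWalk h` is far from the stationary distribution of `h`
(`exists_tvDist_ge_one_step`). Fix a large constant `D`.

* If half of the mass of `μ` sits on vertices of degree at most `D` in `g`, each of these becomes
  isolated in `h` with probability bounded below: its edges die, as `q` is bounded below, and none
  is born, as `p = O(1 / n)`. The walk does not move at an isolated vertex, where the stationary
  distribution vanishes (`tvDist_of_mass_on_low_degree`).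
* Otherwise half of the mass sits on vertices of degree above `D`. Laziness keeps half of it there.
  These vertices carry few edges of `g` because `degSq g` is linear, hence few edges of `h`, while
  `h` has linearly many edges by Chebyshev's inequality, so that the stationary distribution of `h`
  gives them little mass (`tvDist_of_mass_on_high_degree`).

Sparse graphs are typical whatever the initial graph is: `degSq` satisfies the Foster–Lyapunov drift
inequality `edgeMean_degSq_le`, hence after a burn-in that is long compared with `log n` it is
linear in expectation, conditionally on any past. A window of length `√n` contains about
`n ^ (1 / 4)` blocks of length `n ^ (1 / 4)`. Each block consists of a burn-in and one last step,
which leaves the walk far from stationarity with probability bounded below given the past. So being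
mixed through a given window has probability exponentially small in `n ^ (1 / 4)`
(`SparseFast.prob_isMixedFrom_le`). This excludes mixing at any deterministic time and, by a union
bound, at any random time up to `n ^ k`. If the initial graph has the stationary law, it is already
sparse, the drift inequality keeps it sparse, and the one-step statement applies at every single
positive time (`SparseFast.prob_far_succ_ge`); at time `0` the walk is a point mass.

Conditioning on the past is expressed through nonnegative weights `φ` that depend on the graphs up
to the current time, in the form of the Markov property `integral_markov_step`.
-/

namespace DynGraph

/-! ### Random graphs with independent edges -/

section

variable {V : Type*} [Fintype V]

open Classical in
/-- The probability of the graph `h` when every pair `e` of distinct vertices is an edge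
independently with probability `w e`. -/
noncomputable def edgeProd (w : Sym2 V → ℝ) (h : SimpleGraph V) : ℝ :=
  ∏ e ∈ (⊤ : SimpleGraph V).edgeFinset, if e ∈ h.edgeSet then w e else 1 - w e

open Classical in
/-- The expectation of `f` over the random graph with independent edges of probabilities `w`. -/
noncomputable def edgeMean (w : Sym2 V → ℝ) (f : SimpleGraph V → ℝ) : ℝ :=
  ∑ h, edgeProd w h * f h

open Classical in
/-- The number of edges of `h` in `S`, as a real number. -/
noncomputable def edgeCount (S : Finset (Sym2 V)) (h : SimpleGraph V) : ℝ :=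
  ∑ e ∈ S, if e ∈ h.edgeSet then 1 else 0

open Classical in
/-- The sum of a product over all pairs factorizes, because a graph is an arbitrary choice of a
set of pairs. -/
theorem sum_prod_edge (a b : Sym2 V → ℝ) :
    ∑ h : SimpleGraph V, ∏ e ∈ (⊤ : SimpleGraph V).edgeFinset,
      (if e ∈ h.edgeSet then a e else b e) =
      ∏ e ∈ (⊤ : SimpleGraph V).edgeFinset, (a e + b e) := by
  rw [Finset.prod_add]
  refine Finset.sum_bij' (fun h _ => h.edgeFinset)
    (fun t _ => SimpleGraph.fromEdgeSet (t : Set (Sym2 V))) ?_ ?_ ?_ ?_ ?_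
  · intro h _
    simpa using SimpleGraph.edgeFinset_mono (le_top : h ≤ ⊤)
  · intro t _
    exact Finset.mem_univ _
  · intro h _
    simp
  · intro t ht
    ext e
    rw [Finset.mem_powerset] at ht
    have : e ∈ t → ¬ e.IsDiag := fun he => by
      have := ht he
      rw [SimpleGraph.mem_edgeFinset] at this
      exact SimpleGraph.not_isDiag_of_mem_edgeSet _ this
    simp only [SimpleGraph.mem_edgeFinset, SimpleGraph.edgeSet_fromEdgeSet]
    simpa using this
  · intro h _
    have hsub : h.edgeFinset ⊆ (⊤ : SimpleGraph V).edgeFinset :=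
      SimpleGraph.edgeFinset_mono (le_top : h ≤ ⊤)
    rw [← Finset.prod_sdiff hsub, mul_comm]
    congr 1
    · refine Finset.prod_congr rfl fun e he => if_pos ?_
      simpa using he
    · refine Finset.prod_congr rfl fun e he => if_neg ?_
      simp only [Finset.mem_sdiff, SimpleGraph.mem_edgeFinset] at he
      exact he.2

variable {w : Sym2 V → ℝ}

theorem edgeProd_nonneg (hw : ∀ e, w e ∈ Set.Icc (0 : ℝ) 1) (h : SimpleGraph V) :
    0 ≤ edgeProd w h := by
  refine Finset.prod_nonneg fun e _ => ?_
  split_ifs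
  · exact (hw e).1
  · linarith [(hw e).2]

theorem edgeMean_one (w : Sym2 V → ℝ) : edgeMean w (fun _ => 1) = 1 := by
  have := sum_prod_edge w (fun e => 1 - w e)
  simp only [add_sub_cancel, Finset.prod_const_one] at this
  simpa [edgeMean, edgeProd] using this

theorem edgeMean_mono (hw : ∀ e, w e ∈ Set.Icc (0 : ℝ) 1) {f g : SimpleGraph V → ℝ}
    (hfg : ∀ h, f h ≤ g h) : edgeMean w f ≤ edgeMean w g :=
  Finset.sum_le_sum fun h _ => mul_le_mul_of_nonneg_left (hfg h) (edgeProd_nonneg hw h)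

theorem edgeMean_add (w : Sym2 V → ℝ) (f g : SimpleGraph V → ℝ) :
    edgeMean w (fun h => f h + g h) = edgeMean w f + edgeMean w g := by
  simp [edgeMean, mul_add, Finset.sum_add_distrib]

theorem edgeMean_const_mul (w : Sym2 V → ℝ) (c : ℝ) (f : SimpleGraph V → ℝ) :
    edgeMean w (fun h => c * f h) = c * edgeMean w f := by
  simp only [edgeMean, Finset.mul_sum]
  exact Finset.sum_congr rfl fun h _ => by ring

theorem edgeMean_const (w : Sym2 V → ℝ) (c : ℝ) : edgeMean w (fun _ => c) = c := by
  have := edgeMean_const_mul w c (fun _ => 1)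
  simpa [edgeMean_one] using this

theorem edgeMean_sub (w : Sym2 V → ℝ) (f g : SimpleGraph V → ℝ) :
    edgeMean w (fun h => f h - g h) = edgeMean w f - edgeMean w g := by
  simp [edgeMean, mul_sub, Finset.sum_sub_distrib]

theorem edgeMean_sum {ι : Type*} (w : Sym2 V → ℝ) (s : Finset ι) (f : ι → SimpleGraph V → ℝ) :
    edgeMean w (fun h => ∑ i ∈ s, f i h) = ∑ i ∈ s, edgeMean w (f i) := by
  simp only [edgeMean, Finset.mul_sum]
  exact Finset.sum_comm

open Classical in
/-- The probability that all edges in `A` are present and all edges in `B` are absent. -/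
theorem edgeMean_cylinder (w : Sym2 V → ℝ) {A B : Finset (Sym2 V)}
    (hA : A ⊆ (⊤ : SimpleGraph V).edgeFinset) (hB : B ⊆ (⊤ : SimpleGraph V).edgeFinset)
    (hAB : Disjoint A B) :
    edgeMean w (fun h => if (∀ e ∈ A, e ∈ h.edgeSet) ∧ (∀ e ∈ B, e ∉ h.edgeSet) then 1 else 0) =
      (∏ e ∈ A, w e) * ∏ e ∈ B, (1 - w e) := by
  have key := sum_prod_edge (fun e => if e ∈ B then 0 else w e)
    (fun e => if e ∈ A then 0 else 1 - w e)
  have hR : ∏ e ∈ (⊤ : SimpleGraph V).edgeFinset,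
      ((if e ∈ B then 0 else w e) + (if e ∈ A then 0 else 1 - w e)) =
      (∏ e ∈ A, w e) * ∏ e ∈ B, (1 - w e) := by
    have hterm : ∀ e, (if e ∈ B then 0 else w e) + (if e ∈ A then 0 else 1 - w e) =
        (if e ∈ A then w e else 1) * (if e ∈ B then 1 - w e else 1) := by
      intro e
      by_cases h1 : e ∈ A
      · simp [h1, Finset.disjoint_left.1 hAB h1]
      · by_cases h2 : e ∈ B <;> simp [h1, h2]
    simp_rw [hterm, Finset.prod_mul_distrib, Finset.prod_ite_mem,
      Finset.inter_eq_right.2 hA, Finset.inter_eq_right.2 hB]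
  rw [← hR, ← key]
  refine Finset.sum_congr rfl fun h _ => ?_
  unfold edgeProd
  beta_reduce
  split_ifs with hc
  · rw [mul_one]
    refine Finset.prod_congr rfl fun e he => ?_
    split_ifs with h1 h2 h3
    · exact absurd h1 (hc.2 e h2)
    · rfl
    · exact absurd (hc.1 e h3) h1
    · rfl
  · rw [mul_zero, eq_comm]
    rw [not_and_or] at hc
    push Not at hc
    rcases hc with ⟨e, he, hn⟩ | ⟨e, he, hn⟩
    · exact Finset.prod_eq_zero (hA he) (by simp [hn, he])
    · exact Finset.prod_eq_zero (hB he) (by simp [hn, he])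

open Classical in
theorem edgeMean_edge (w : Sym2 V → ℝ) {e : Sym2 V}
    (he : e ∈ (⊤ : SimpleGraph V).edgeFinset) :
    edgeMean w (fun h => if e ∈ h.edgeSet then 1 else 0) = w e := by
  have := edgeMean_cylinder w (A := {e}) (B := ∅) (by simpa using he) (by simp) (by simp)
  simpa using this

open Classical in
theorem edgeMean_edge_mul_edge (w : Sym2 V → ℝ) {e f : Sym2 V}
    (he : e ∈ (⊤ : SimpleGraph V).edgeFinset) (hf : f ∈ (⊤ : SimpleGraph V).edgeFinset) :
    edgeMean w (fun h => (if e ∈ h.edgeSet then 1 else 0) * (if f ∈ h.edgeSet then 1 else 0)) =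
      if e = f then w e else w e * w f := by
  split_ifs with hef
  · subst hef
    rw [← edgeMean_edge w he]
    congr 1
    ext h
    split_ifs <;> simp
  · have := edgeMean_cylinder w (A := {e, f}) (B := ∅)
      (by intro x hx; simp only [Finset.mem_insert, Finset.mem_singleton] at hx
          rcases hx with rfl | rfl <;> assumption) (by simp) (by simp)
    rw [Finset.prod_pair hef, Finset.prod_empty, mul_one] at this
    rw [← this]
    congr 1
    ext h
    by_cases h1 : e ∈ h.edgeSet <;> by_cases h2 : f ∈ h.edgeSet <;> simp [h1, h2]

theorem edgeMean_edgeCount (w : Sym2 V → ℝ) {S : Finset (Sym2 V)}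
    (hS : ∀ e ∈ S, ¬ e.IsDiag) : edgeMean w (edgeCount S) = ∑ e ∈ S, w e := by
  classical
  have : edgeCount S = fun h => ∑ e ∈ S, if e ∈ h.edgeSet then (1 : ℝ) else 0 := by
    ext h; simp [edgeCount]
  rw [this, edgeMean_sum]
  refine Finset.sum_congr rfl fun e he => ?_
  convert edgeMean_edge w (e := e) (by simpa using hS e he)

theorem edgeMean_edgeCount_sq_le (w : Sym2 V → ℝ) {S : Finset (Sym2 V)}
    (hS : ∀ e ∈ S, ¬ e.IsDiag) :
    edgeMean w (fun h => edgeCount S h ^ 2) ≤ (∑ e ∈ S, w e) + (∑ e ∈ S, w e) ^ 2 := by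
  classical
  have h1 : (fun h => edgeCount S h ^ 2) = fun h : SimpleGraph V => ∑ e ∈ S, ∑ f ∈ S,
      (if e ∈ h.edgeSet then (1 : ℝ) else 0) * (if f ∈ h.edgeSet then 1 else 0) := by
    ext h
    rw [sq, edgeCount, Finset.sum_mul_sum]
  rw [h1, edgeMean_sum, sq, Finset.sum_mul_sum, ← Finset.sum_add_distrib]
  refine Finset.sum_le_sum fun e he => ?_
  rw [edgeMean_sum]
  have h2 : ∀ f ∈ S, edgeMean w (fun h => (if e ∈ h.edgeSet then (1 : ℝ) else 0) *
      (if f ∈ h.edgeSet then 1 else 0)) ≤ (if e = f then w e else 0) + w e * w f := by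
    intro f hf
    have := edgeMean_edge_mul_edge w (e := e) (f := f) (by simpa using hS e he)
      (by simpa using hS f hf)
    have h3 : edgeMean w (fun h => (if e ∈ h.edgeSet then (1 : ℝ) else 0) *
      (if f ∈ h.edgeSet then 1 else 0)) = if e = f then w e else w e * w f := by
      convert this
    rw [h3]
    split_ifs with hef
    · subst hef
      nlinarith [mul_self_nonneg (w e)]
    · simp
  refine (Finset.sum_le_sum h2).trans (le_of_eq ?_)
  rw [Finset.sum_add_distrib, Finset.sum_ite_eq, if_pos he]

/-- The variance of the number of edges in `S` is at most its mean. -/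
theorem edgeMean_edgeCount_sub_sq_le (w : Sym2 V → ℝ) {S : Finset (Sym2 V)}
    (hS : ∀ e ∈ S, ¬ e.IsDiag) :
    edgeMean w (fun h => (edgeCount S h - ∑ e ∈ S, w e) ^ 2) ≤ ∑ e ∈ S, w e := by
  set m := ∑ e ∈ S, w e with hm
  have h1 : (fun h => (edgeCount S h - m) ^ 2) = fun h : SimpleGraph V =>
      (edgeCount S h ^ 2 - (2 * m) * edgeCount S h) + m ^ 2 := by
    ext h; ring
  rw [h1, edgeMean_add, edgeMean_sub, edgeMean_const_mul, edgeMean_const, edgeMean_edgeCount w hS]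
  have := edgeMean_edgeCount_sq_le w hS
  rw [← hm] at this ⊢
  nlinarith

open Classical in
/-- Pairs of distinct vertices containing `v`. -/
noncomputable def pairsAt (v : V) : Finset (Sym2 V) := (⊤ : SimpleGraph V).incidenceFinset v

theorem not_isDiag_of_mem_pairsAt {v : V} {e : Sym2 V} (he : e ∈ pairsAt v) : ¬ e.IsDiag := by
  simp only [pairsAt, SimpleGraph.mem_incidenceFinset] at he
  exact SimpleGraph.not_isDiag_of_mem_edgeSet _ he.1

theorem card_pairsAt (v : V) : ((pairsAt v).card : ℝ) ≤ Fintype.card V := by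
  classical
  rw [pairsAt, SimpleGraph.card_incidenceFinset_eq_degree]
  exact_mod_cast (SimpleGraph.degree_lt_card_verts (v := v)).le

open Classical in
theorem edgeCount_pairsAt (v : V) (h : SimpleGraph V) :
    edgeCount (pairsAt v) h = (h.degree v : ℝ) := by
  rw [← SimpleGraph.card_incidenceFinset_eq_degree, edgeCount, ← Finset.sum_filter,
    Finset.sum_const, nsmul_eq_mul, mul_one]
  congr 2
  ext e
  simp only [pairsAt, Finset.mem_filter, SimpleGraph.mem_incidenceFinset,
    SimpleGraph.incidenceSet, Set.mem_ofPred_eq]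
  have : e ∈ h.edgeSet → e ∈ (⊤ : SimpleGraph V).edgeSet :=
    fun he => SimpleGraph.edgeSet_mono le_top he
  tauto

open Classical in
theorem edgeCount_top (h : SimpleGraph V) :
    edgeCount (⊤ : SimpleGraph V).edgeFinset h = (h.edgeFinset.card : ℝ) := by
  rw [edgeCount, ← Finset.sum_filter, Finset.sum_const, nsmul_eq_mul, mul_one]
  congr 2
  ext e
  simp only [Finset.mem_filter, SimpleGraph.mem_edgeFinset]
  exact ⟨fun h => h.2, fun he => ⟨SimpleGraph.edgeSet_mono le_top he, he⟩⟩

open Classical in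
theorem edgeMean_isolated (w : Sym2 V → ℝ) (v : V) :
    edgeMean w (fun h => if h.degree v = 0 then 1 else 0) = ∏ e ∈ pairsAt v, (1 - w e) := by
  have := edgeMean_cylinder w (A := ∅) (B := pairsAt v) (by simp)
    (by intro e he; simpa using not_isDiag_of_mem_pairsAt he) (by simp)
  rw [Finset.prod_empty, one_mul] at this
  rw [← this]
  congr 1
  ext h
  refine if_congr ?_ rfl rfl
  have h1 := edgeCount_pairsAt v h
  rw [edgeCount] at h1
  constructor
  · intro h0
    rw [h0, Nat.cast_zero,
      Finset.sum_eq_zero_iff_of_nonneg (fun _ _ => by split_ifs <;> simp)] at h1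
    refine ⟨by simp, fun e he hh => ?_⟩
    have := h1 e he
    simp [hh] at this
  · rintro ⟨-, h2⟩
    rw [Finset.sum_eq_zero (fun e he => if_neg (h2 e he))] at h1
    exact_mod_cast h1.symm

end

/-! ### Drift of the sum of squared degrees -/

section

variable {V : Type*} [Fintype V]

open Classical in
/-- The probability that `e` is an edge one step after the edge-Markovian graph is `g`. -/
noncomputable def evolve (p q : ℝ) (g : SimpleGraph V) (e : Sym2 V) : ℝ :=
  if e ∈ g.edgeSet then 1 - q else p

open Classical in
/-- The sum of the squared degrees of `g`. -/
noncomputable def degSq (g : SimpleGraph V) : ℝ := ∑ v, (g.degree v : ℝ) ^ 2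

theorem edgeTransProb_eq_edgeProd (p q : ℝ) (g h : SimpleGraph V) :
    edgeTransProb p q g h = edgeProd (evolve p q g) h := by
  classical
  unfold edgeTransProb edgeProd evolve
  refine Finset.prod_congr rfl fun e _ => ?_
  split_ifs <;> ring

omit [Fintype V] in
theorem evolve_mem_Icc {p q : ℝ} (hp : p ∈ Set.Icc (0 : ℝ) 1) (hq : q ∈ Set.Icc (0 : ℝ) 1)
    (g : SimpleGraph V) (e : Sym2 V) : evolve p q g e ∈ Set.Icc (0 : ℝ) 1 := by
  unfold evolve
  split_ifs
  · exact ⟨by linarith [hq.2], by linarith [hq.1]⟩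
  · exact hp

theorem degSq_nonneg (g : SimpleGraph V) : 0 ≤ degSq g :=
  Finset.sum_nonneg fun _ _ => sq_nonneg _

theorem degSq_le (g : SimpleGraph V) : degSq g ≤ (Fintype.card V : ℝ) ^ 3 := by
  classical
  have : ∀ v ∈ (Finset.univ : Finset V), (g.degree v : ℝ) ^ 2 ≤ (Fintype.card V : ℝ) ^ 2 := by
    intro v _
    have : (g.degree v : ℝ) ≤ Fintype.card V := by exact_mod_cast (g.degree_lt_card_verts v).le
    gcongr
  unfold degSq
  refine (Finset.sum_le_card_nsmul _ _ _ ?_).trans (le_of_eq (?_ :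
    (Finset.univ : Finset V).card • (Fintype.card V : ℝ) ^ 2 = _))
  · intro v hv
    convert this v hv
  · rw [nsmul_eq_mul, Finset.card_univ]; ring

open Classical in
theorem sum_evolve_le {p q : ℝ} (hp : 0 ≤ p) (g : SimpleGraph V) (v : V) :
    ∑ e ∈ pairsAt v, evolve p q g e ≤ (1 - q) * g.degree v + p * Fintype.card V := by
  have h1 : ∀ e ∈ pairsAt v, evolve p q g e ≤
      (1 - q) * (if e ∈ g.edgeSet then 1 else 0) + p := by
    intro e _
    unfold evolve
    split_ifs <;> linarith
  refine (Finset.sum_le_sum h1).trans ?_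
  rw [Finset.sum_add_distrib, ← Finset.mul_sum, Finset.sum_const, nsmul_eq_mul]
  have h2 := edgeCount_pairsAt v g
  unfold edgeCount at h2
  rw [h2]
  nlinarith [card_pairsAt v]

/-- The additive constant in the drift inequality for the sum of squared degrees. -/
noncomputable def driftConst (C q₀ : ℝ) : ℝ := (2 * C + 1) ^ 2 / (4 * q₀) + C ^ 2 + C

theorem driftConst_nonneg {C q₀ : ℝ} (hC : 0 ≤ C) (hq₀ : 0 < q₀) : 0 ≤ driftConst C q₀ := by
  unfold driftConst; positivity

theorem edgeMean_degSq (w : Sym2 V → ℝ) :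
    edgeMean w degSq = ∑ v, edgeMean w (fun h => edgeCount (pairsAt v) h ^ 2) := by
  classical
  rw [← edgeMean_sum]
  congr 1
  ext h
  simp only [edgeCount_pairsAt, degSq]

/-- Foster–Lyapunov drift: in one step the sum of squared degrees contracts by the factor `1 - q₀`
up to a term linear in the number of vertices. -/
theorem edgeMean_degSq_le {p q C q₀ : ℝ} (hp : 0 ≤ p) (hq₀ : 0 < q₀)
    (hq : q₀ ≤ q) (hq1 : q ≤ 1) (hpC : p * Fintype.card V ≤ C) (g : SimpleGraph V) :
    edgeMean (evolve p q g) degSq ≤ (1 - q₀) * degSq g + driftConst C q₀ * Fintype.card V := by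
  classical
  have hC : 0 ≤ C := le_trans (by positivity) hpC
  rw [edgeMean_degSq]
  have hv : ∀ v ∈ (Finset.univ : Finset V), edgeMean (evolve p q g)
      (fun h => edgeCount (pairsAt v) h ^ 2) ≤
      (1 - q₀) * (g.degree v : ℝ) ^ 2 + driftConst C q₀ := by
    intro v _
    refine (edgeMean_edgeCount_sq_le _ fun e he => not_isDiag_of_mem_pairsAt he).trans ?_
    set m := ∑ e ∈ pairsAt v, evolve p q g e with hm
    set d : ℝ := (g.degree v : ℝ) with hd
    have hd0 : 0 ≤ d := by positivity
    have hm0 : 0 ≤ m := Finset.sum_nonneg fun e _ => by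
      unfold evolve; split_ifs <;> linarith
    have hm1 : m ≤ (1 - q₀) * d + C := by
      have := sum_evolve_le (q := q) hp g v
      nlinarith
    set r := 1 - q₀ with hr
    have hr0 : 0 ≤ r := by linarith
    have h1 : m + m ^ 2 ≤ (r * d + C) + (r * d + C) ^ 2 := by
      gcongr
    -- complete the square to absorb the term linear in `d` into `q₀ * d ^ 2`
    have h2 : (2 * C + 1) * d ≤ q₀ * d ^ 2 + (2 * C + 1) ^ 2 / (4 * q₀) := by
      have h4 : (2 * C + 1) ^ 2 / (4 * q₀) * (4 * q₀) = (2 * C + 1) ^ 2 := by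
        field_simp
      have h5 := sq_nonneg (2 * q₀ * d - (2 * C + 1))
      have h6 : 0 < 4 * q₀ := by positivity
      nlinarith
    have h3 : r * ((2 * C + 1) * d) ≤ r * (q₀ * d ^ 2) + (2 * C + 1) ^ 2 / (4 * q₀) := by
      have h7 : 0 ≤ (2 * C + 1) ^ 2 / (4 * q₀) := by positivity
      have h8 : r ≤ 1 := by linarith
      nlinarith
    unfold driftConst
    have h9 : q₀ = 1 - r := by linarith
    calc m + m ^ 2 ≤ (r * d + C) + (r * d + C) ^ 2 := h1
      _ = r ^ 2 * d ^ 2 + r * ((2 * C + 1) * d) + C ^ 2 + C := by ring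
      _ ≤ r ^ 2 * d ^ 2 + (r * (q₀ * d ^ 2) + (2 * C + 1) ^ 2 / (4 * q₀)) + C ^ 2 + C := by
          linarith
      _ = r * d ^ 2 + ((2 * C + 1) ^ 2 / (4 * q₀) + C ^ 2 + C) := by
          rw [hr]; ring
  refine (Finset.sum_le_sum hv).trans (le_of_eq ?_)
  rw [Finset.sum_add_distrib, ← Finset.mul_sum, Finset.sum_const, nsmul_eq_mul, Finset.card_univ]
  unfold degSq
  ring

open Classical in
theorem card_edgeFinset_le_degSq (g : SimpleGraph V) :
    (g.edgeFinset.card : ℝ) ≤ degSq g / 2 := by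
  have h1 : (∑ v, (g.degree v : ℝ)) = 2 * g.edgeFinset.card := by
    exact_mod_cast g.sum_degrees_eq_twice_card_edges
  have h2 : (∑ v, (g.degree v : ℝ)) ≤ degSq g := by
    unfold degSq
    refine Finset.sum_le_sum fun v _ => ?_
    have : (g.degree v) ≤ g.degree v ^ 2 := Nat.le_self_pow two_ne_zero _
    exact_mod_cast this
  linarith

open Classical in
theorem le_sum_evolve {p q : ℝ} (hp : 0 ≤ p) (hq : q ≤ 1) (g : SimpleGraph V) :
    p * ((Fintype.card V : ℝ) * (Fintype.card V - 1) / 2 - degSq g / 2) ≤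
      ∑ e ∈ (⊤ : SimpleGraph V).edgeFinset, evolve p q g e := by
  have h1 : ∀ e ∈ (⊤ : SimpleGraph V).edgeFinset,
      p - p * (if e ∈ g.edgeSet then 1 else 0) ≤ evolve p q g e := by
    intro e _
    unfold evolve
    split_ifs <;> linarith
  refine le_trans ?_ (Finset.sum_le_sum h1)
  rw [Finset.sum_sub_distrib, ← Finset.mul_sum, Finset.sum_const, nsmul_eq_mul]
  have h2 := edgeCount_top g
  unfold edgeCount at h2
  rw [h2, SimpleGraph.card_edgeFinset_top_eq_card_choose_two, Nat.cast_choose_two]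
  nlinarith [card_edgeFinset_le_degSq g]

end

/-! ### One step of the walk -/

section

variable {V : Type*} [Fintype V]

theorem lazyWalk_nonneg (g : SimpleGraph V) (u v : V) : 0 ≤ lazyWalk g u v := by
  classical
  unfold lazyWalk
  split_ifs <;> positivity

theorem half_le_lazyWalk_self (g : SimpleGraph V) (u : V) : 1 / 2 ≤ lazyWalk g u u := by
  classical
  unfold lazyWalk
  split_ifs <;> norm_num at *

theorem sum_lazyWalk (g : SimpleGraph V) (u : V) : ∑ v, lazyWalk g u v = 1 := by
  classical
  by_cases h0 : g.degree u = 0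
  · have : ∀ v, lazyWalk g u v = if u = v then 1 else 0 := by
      intro v
      unfold lazyWalk
      rw [if_pos]
      convert h0
    simp [this]
  · have h1 : ∀ v, lazyWalk g u v = (if u = v then 1 / 2 else 0) +
        (if g.Adj u v then 1 / (2 * (g.degree u : ℝ)) else 0) := by
      intro v
      unfold lazyWalk
      rw [if_neg (by convert h0)]
      by_cases huv : u = v
      · subst huv; simp
      · simp only [huv, if_false, zero_add]
    simp_rw [h1]
    rw [Finset.sum_add_distrib, Finset.sum_ite_eq, if_pos (Finset.mem_univ _), ← Finset.sum_filter,
      Finset.sum_const, ← SimpleGraph.neighborFinset_eq_filter,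
      SimpleGraph.card_neighborFinset_eq_degree, nsmul_eq_mul]
    have : (g.degree u : ℝ) ≠ 0 := by exact_mod_cast h0
    field_simp
    norm_num

/-- The one-step distribution keeps at least half of the mass of every vertex. -/
theorem half_le_vecMul_lazyWalk {μ : V → ℝ} (hμ : ∀ v, 0 ≤ μ v) (g : SimpleGraph V) (v : V) :
    μ v / 2 ≤ Matrix.vecMul μ (lazyWalk g) v := by
  have h1 : μ v * lazyWalk g v v ≤ Matrix.vecMul μ (lazyWalk g) v := by
    simp only [Matrix.vecMul, dotProduct]
    exact Finset.single_le_sum (f := fun u => μ u * lazyWalk g u v)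
      (fun u _ => mul_nonneg (hμ u) (lazyWalk_nonneg g u v)) (Finset.mem_univ v)
  nlinarith [hμ v, half_le_lazyWalk_self g v]

open Classical in
theorem le_vecMul_lazyWalk_of_degree_eq_zero {μ : V → ℝ} (hμ : ∀ v, 0 ≤ μ v)
    (g : SimpleGraph V) {v : V} (hv : g.degree v = 0) :
    μ v ≤ Matrix.vecMul μ (lazyWalk g) v := by
  have h1 : μ v * lazyWalk g v v ≤ Matrix.vecMul μ (lazyWalk g) v := by
    simp only [Matrix.vecMul, dotProduct]
    exact Finset.single_le_sum (f := fun u => μ u * lazyWalk g u v)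
      (fun u _ => mul_nonneg (hμ u) (lazyWalk_nonneg g u v)) (Finset.mem_univ v)
  have h2 : lazyWalk g v v = 1 := by
    unfold lazyWalk
    rw [if_pos (by convert hv), if_pos rfl]
  rwa [h2, mul_one] at h1

theorem vecMul_lazyWalk_nonneg {μ : V → ℝ} (hμ : ∀ v, 0 ≤ μ v) (g : SimpleGraph V) (v : V) :
    0 ≤ Matrix.vecMul μ (lazyWalk g) v :=
  le_trans (by linarith [hμ v]) (half_le_vecMul_lazyWalk hμ g v)

theorem sum_vecMul_lazyWalk (μ : V → ℝ) (g : SimpleGraph V) :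
    ∑ v, Matrix.vecMul μ (lazyWalk g) v = ∑ v, μ v := by
  simp only [Matrix.vecMul, dotProduct]
  rw [Finset.sum_comm]
  simp [← Finset.mul_sum, sum_lazyWalk]

theorem walkDist_nonneg (g : ℕ → SimpleGraph V) (x : V) (t : ℕ) (v : V) :
    0 ≤ walkDist g x t v := by
  classical
  induction t generalizing v with
  | zero =>
    simp only [walkDist, Pi.single_apply]
    split_ifs <;> norm_num
  | succ t ih => exact vecMul_lazyWalk_nonneg ih _ v

theorem sum_walkDist (g : ℕ → SimpleGraph V) (x : V) (t : ℕ) : ∑ v, walkDist g x t v = 1 := by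
  classical
  induction t with
  | zero => simp [walkDist]
  | succ t ih => rw [← ih]; exact sum_vecMul_lazyWalk _ _

theorem half_sub_le_tvDist (f g : V → ℝ) (S : Finset V) :
    (∑ v ∈ S, f v - ∑ v ∈ S, g v) / 2 ≤ tvDist f g := by
  unfold tvDist
  have h1 : ∑ v ∈ S, f v - ∑ v ∈ S, g v ≤ ∑ v ∈ S, |f v - g v| := by
    rw [← Finset.sum_sub_distrib]
    exact Finset.sum_le_sum fun v _ => le_abs_self _
  have h2 : ∑ v ∈ S, |f v - g v| ≤ ∑ v, |f v - g v| :=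
    Finset.sum_le_sum_of_subset_of_nonneg (Finset.subset_univ _) fun _ _ _ => abs_nonneg _
  linarith

/-- A vertex of degree at most `D` becomes isolated with probability bounded below. -/
theorem prod_one_sub_evolve_ge {p q q₀ C : ℝ} (hp : 0 ≤ p) (hp2 : p ≤ 1 / 2) (hq₀ : 0 < q₀)
    (hq : q₀ ≤ q) (hq1 : q₀ ≤ 1) (hpC : p * Fintype.card V ≤ C) (g : SimpleGraph V) (v : V) (D : ℕ)
    (hD : edgeCount (pairsAt v) g ≤ D) :
    q₀ ^ D * Real.exp (-(2 * C)) ≤ ∏ e ∈ pairsAt v, (1 - evolve p q g e) := by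
  classical
  have h1 : ∏ e ∈ pairsAt v, ((if e ∈ g.edgeSet then q₀ else 1) * Real.exp (-(2 * p))) ≤
      ∏ e ∈ pairsAt v, (1 - evolve p q g e) := by
    refine Finset.prod_le_prod (fun e _ => by split_ifs <;> positivity) fun e _ => ?_
    -- equivalent to `1 ≤ (1 + 2 * p) * (1 - p)`, which holds for `p ≤ 1 / 2`
    have h2 : Real.exp (-(2 * p)) ≤ 1 - p := by
      rw [Real.exp_neg, inv_le_comm₀ (Real.exp_pos _) (by linarith)]
      refine le_trans ?_ (Real.add_one_le_exp _)
      rw [inv_le_iff_one_le_mul₀ (by linarith)]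
      nlinarith
    have h3 : Real.exp (-(2 * p)) ≤ 1 := Real.exp_le_one_iff.2 (by linarith)
    unfold evolve
    split_ifs
    · nlinarith
    · linarith
  refine le_trans ?_ h1
  rw [Finset.prod_mul_distrib, Finset.prod_const, ← Real.exp_nat_mul]
  have h4 : q₀ ^ D ≤ ∏ e ∈ pairsAt v, (if e ∈ g.edgeSet then q₀ else 1) := by
    rw [← Finset.prod_filter, Finset.prod_const]
    refine pow_le_pow_of_le_one hq₀.le hq1 ?_
    unfold edgeCount at hD
    rw [← Finset.sum_filter, Finset.sum_const, nsmul_eq_mul, mul_one] at hD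
    exact_mod_cast hD
  have h5 : Real.exp (-(2 * C)) ≤ Real.exp ((pairsAt v).card * -(2 * p)) := by
    rw [Real.exp_le_exp]
    nlinarith [card_pairsAt v]
  exact mul_le_mul h4 h5 (Real.exp_pos _).le (le_trans (by positivity) h4)

open Classical in
/-- If at least half of the mass sits on vertices of degree at most `D`, then with probability
bounded below a fixed part of it sits on vertices that become isolated; that part does not move,
while the stationary distribution vanishes there. -/
theorem tvDist_of_mass_on_low_degree {p q q₀ C : ℝ} (hp : p ∈ Set.Icc (0 : ℝ) 1)
    (hq01 : q ∈ Set.Icc (0 : ℝ) 1) (hp2 : p ≤ 1 / 2)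
    (hq₀ : 0 < q₀) (hq : q₀ ≤ q) (hpC : p * Fintype.card V ≤ C) (g : SimpleGraph V)
    (D : ℕ) {μ : V → ℝ} (hμ : ∀ v, 0 ≤ μ v) (hμ1 : ∑ v, μ v = 1)
    (hlow : 1 / 2 ≤ ∑ v with g.degree v ≤ D, μ v) :
    q₀ ^ D * Real.exp (-(2 * C)) / 4 ≤ edgeMean (evolve p q g) (fun h =>
      if q₀ ^ D * Real.exp (-(2 * C)) / 8 ≤ tvDist (Matrix.vecMul μ (lazyWalk h)) (statDist h)
      then 1 else 0) := by
  set κ := q₀ ^ D * Real.exp (-(2 * C)) with hκ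
  have hw := evolve_mem_Icc hp hq01 g
  have hκ0 : 0 < κ := by positivity
  have hX : κ / 2 ≤ edgeMean (evolve p q g)
      (fun h => ∑ v, μ v * (if h.degree v = 0 then 1 else 0)) := by
    rw [edgeMean_sum]
    have h1 : ∑ v with g.degree v ≤ D, μ v * κ ≤
        ∑ v, edgeMean (evolve p q g) (fun h => μ v * (if h.degree v = 0 then 1 else 0)) := by
      have h2 : ∀ v, edgeMean (evolve p q g) (fun h => μ v * (if h.degree v = 0 then 1 else 0)) =
          μ v * ∏ e ∈ pairsAt v, (1 - evolve p q g e) := fun v => by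
        rw [edgeMean_const_mul, edgeMean_isolated]
      rw [Finset.sum_congr rfl fun v _ => h2 v]
      refine le_trans (Finset.sum_le_sum (g := fun v => μ v *
        ∏ e ∈ pairsAt v, (1 - evolve p q g e)) fun v hv => ?_)
        (Finset.sum_le_sum_of_subset_of_nonneg (Finset.subset_univ _) fun v _ _ =>
          mul_nonneg (hμ v) (Finset.prod_nonneg fun e _ => by linarith [(hw e).2]))
      refine mul_le_mul_of_nonneg_left (prod_one_sub_evolve_ge hp.1 hp2 hq₀ hq (hq.trans hq01.2) hpC
        g v D ?_) (hμ v)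
      rw [edgeCount_pairsAt]
      simpa using hv
    rw [← Finset.sum_mul] at h1
    nlinarith
  have hle : edgeMean (evolve p q g) (fun h => ∑ v, μ v * (if h.degree v = 0 then 1 else 0)) ≤
      edgeMean (evolve p q g) (fun h => (if κ / 8 ≤
        tvDist (Matrix.vecMul μ (lazyWalk h)) (statDist h) then 1 else 0) + κ / 4) := by
    refine edgeMean_mono hw fun h => ?_
    have hle1 : ∑ v, μ v * (if h.degree v = 0 then 1 else 0) ≤ 1 := by
      refine le_trans (Finset.sum_le_sum fun v _ => ?_) hμ1.le
      split_ifs <;> simp [hμ v]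
    have htv : (∑ v, μ v * (if h.degree v = 0 then 1 else 0)) / 2 ≤
        tvDist (Matrix.vecMul μ (lazyWalk h)) (statDist h) := by
      refine le_trans ?_ (half_sub_le_tvDist _ _ (Finset.univ.filter fun v => h.degree v = 0))
      have h2 : ∑ v with h.degree v = 0, statDist h v = 0 := by
        refine Finset.sum_eq_zero fun v hv => ?_
        have hv' : h.degree v = 0 := by simpa using hv
        simp [statDist, hv']
      rw [h2, sub_zero]
      simp_rw [mul_ite, mul_one, mul_zero]
      rw [← Finset.sum_filter]
      gcongr with v hv
      exact le_vecMul_lazyWalk_of_degree_eq_zero hμ h (by simpa using hv)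
    split_ifs with hc
    · linarith
    · linarith
  rw [edgeMean_add, edgeMean_const] at hle
  linarith

open Classical in
/-- If at least half of the mass sits on vertices of degree above `D`, then laziness keeps a quarter
of the mass there, while these vertices have few edges, before and after the step. -/
theorem tvDist_of_mass_on_high_degree {p q C a M : ℝ} (hp : p ∈ Set.Icc (0 : ℝ) 1)
    (hq01 : q ∈ Set.Icc (0 : ℝ) 1) (hpC : p * Fintype.card V ≤ C)
    (ha : 0 < a) (hpa : a ≤ p * Fintype.card V)
    (g : SimpleGraph V) (hM : degSq g ≤ M * Fintype.card V)
    {D : ℕ} (hD : 128 * (1 + C) * M ≤ a * D) (hD0 : 0 < D)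
    (hn1 : 2 * (M + 1) ≤ Fintype.card V) (hn2 : 64 ≤ a * Fintype.card V)
    {μ : V → ℝ} (hμ : ∀ v, 0 ≤ μ v)
    (hhigh : 1 / 2 ≤ ∑ v with D < g.degree v, μ v) :
    1 / 2 ≤ edgeMean (evolve p q g) (fun h =>
      if 1 / 16 ≤ tvDist (Matrix.vecMul μ (lazyWalk h)) (statDist h) then 1 else 0) := by
  set n : ℝ := (Fintype.card V : ℝ) with hn
  have hw := evolve_mem_Icc hp hq01 g
  set m := ∑ e ∈ (⊤ : SimpleGraph V).edgeFinset, evolve p q g e with hm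
  set H := Finset.univ.filter fun v => D < g.degree v with hH
  have hn0 : 0 < n := by
    by_contra hcon
    nlinarith
  have hC : 0 ≤ C := le_trans (by positivity) (ha.le.trans hpa |>.trans hpC)
  have hM0 : 0 ≤ M := by
    have := (degSq_nonneg g).trans hM
    by_contra hcon
    nlinarith
  have hD' : (0 : ℝ) < D := by exact_mod_cast hD0
  -- the expected number of edges
  have hma : a * n / 4 ≤ m := by
    have h1 := le_sum_evolve hp.1 hq01.2 g (p := p)
    rw [← hm, ← hn] at h1
    have h2 : p * (n * (n / 2) / 2) ≤ p * (n * (n - 1) / 2 - degSq g / 2) := by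
      refine mul_le_mul_of_nonneg_left ?_ hp.1
      nlinarith
    nlinarith
  have hdiag : ∀ e ∈ (⊤ : SimpleGraph V).edgeFinset, ¬ e.IsDiag := fun e he => by simpa using he
  have hvar := edgeMean_edgeCount_sub_sq_le (evolve p q g) hdiag
  rw [← hm] at hvar
  have hm16 : 16 ≤ m := by linarith
  -- the expected volume of the high-degree vertices
  have hvol : edgeMean (evolve p q g) (fun h => ∑ v ∈ H, (h.degree v : ℝ)) ≤
      (1 + C) * M * n / D := by
    rw [edgeMean_sum]
    have h1 : ∀ v ∈ H, edgeMean (evolve p q g) (fun h => (h.degree v : ℝ)) ≤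
        (1 + C) * (g.degree v : ℝ) ^ 2 / D := by
      intro v hv
      have hv' : D < g.degree v := by simpa [hH] using hv
      have hv2 : (D : ℝ) ≤ g.degree v := by exact_mod_cast hv'.le
      have hv1 : (1 : ℝ) ≤ g.degree v := by exact_mod_cast (Nat.one_le_iff_ne_zero.2 (by omega))
      have h2 := edgeMean_edgeCount (evolve p q g) (S := pairsAt v)
        fun e he => not_isDiag_of_mem_pairsAt he
      have h3 : edgeCount (pairsAt v) = fun h : SimpleGraph V => (h.degree v : ℝ) := by
        ext h; rw [edgeCount_pairsAt]
      rw [h3] at h2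
      rw [h2]
      refine (sum_evolve_le hp.1 g v).trans ?_
      rw [le_div_iff₀ hD']
      have h4 : (1 - q) * (g.degree v : ℝ) + p * n ≤ (1 + C) * g.degree v := by
        nlinarith [hq01.1]
      calc ((1 - q) * (g.degree v : ℝ) + p * n) * D ≤ ((1 + C) * g.degree v) * g.degree v := by
            gcongr
        _ = _ := by ring
    refine (Finset.sum_le_sum h1).trans ?_
    rw [← Finset.sum_div, ← Finset.mul_sum]
    have h5 : ∑ v ∈ H, (g.degree v : ℝ) ^ 2 ≤ M * n := by
      refine le_trans ?_ hM
      unfold degSq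
      exact Finset.sum_le_sum_of_subset_of_nonneg (Finset.subset_univ _) fun _ _ _ => sq_nonneg _
    rw [mul_assoc]
    gcongr
  -- union bound over the failures of the two estimates, by Chebyshev's and Markov's inequalities
  have hpt : edgeMean (evolve p q g) (fun h => 1 - (4 / m ^ 2) * (edgeCount
      (⊤ : SimpleGraph V).edgeFinset h - m) ^ 2 - (8 / m) * ∑ v ∈ H, (h.degree v : ℝ)) ≤
      edgeMean (evolve p q g) (fun h =>
      if 1 / 16 ≤ tvDist (Matrix.vecMul μ (lazyWalk h)) (statDist h) then 1 else 0) := by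
    refine edgeMean_mono hw fun h => ?_
    have hvol0 : 0 ≤ ∑ v ∈ H, (h.degree v : ℝ) := Finset.sum_nonneg fun _ _ => by positivity
    have hs0 : 0 ≤ (4 / m ^ 2) * (edgeCount (⊤ : SimpleGraph V).edgeFinset h - m) ^ 2 := by
      positivity
    have hv0 : 0 ≤ (8 / m) * ∑ v ∈ H, (h.degree v : ℝ) := by positivity
    split_ifs with hc
    · linarith
    · by_contra hcon
      push Not at hcon
      apply hc
      have hX : m / 2 ≤ edgeCount (⊤ : SimpleGraph V).edgeFinset h := by
        by_contra hX
        push Not at hX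
        have h6 : (m / 2) ^ 2 ≤ (edgeCount (⊤ : SimpleGraph V).edgeFinset h - m) ^ 2 := by
          nlinarith
        have h7 : 1 ≤ (4 / m ^ 2) *
            (edgeCount (⊤ : SimpleGraph V).edgeFinset h - m) ^ 2 := by
          calc (1 : ℝ) = 4 / m ^ 2 * (m / 2) ^ 2 := by field_simp; norm_num
            _ ≤ _ := by gcongr
        linarith
      rw [edgeCount_top] at hX
      have hvolm : ∑ v ∈ H, (h.degree v : ℝ) ≤ m / 8 := by
        have h8 : (8 / m) * ∑ v ∈ H, (h.degree v : ℝ) ≤ 1 := by linarith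
        have h9 : (8 / m) * ∑ v ∈ H, (h.degree v : ℝ) =
            (∑ v ∈ H, (h.degree v : ℝ)) / (m / 8) := by field_simp
        rw [h9, div_le_one (by positivity)] at h8
        exact h8
      have hpi : ∑ v ∈ H, statDist h v ≤ 1 / 8 := by
        have h10 : ∀ v, statDist h v = (h.degree v : ℝ) / (2 * (h.edgeFinset.card : ℝ)) := by
          intro v
          simp [statDist]
        simp_rw [h10]
        rw [← Finset.sum_div, div_le_iff₀ (by linarith)]
        linarith
      have hkeep : 1 / 4 ≤ ∑ v ∈ H, Matrix.vecMul μ (lazyWalk h) v := by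
        calc (1 / 4 : ℝ) ≤ ∑ v ∈ H, μ v / 2 := by rw [← Finset.sum_div]; linarith
          _ ≤ _ := Finset.sum_le_sum fun v _ => half_le_vecMul_lazyWalk hμ h v
      have := half_sub_le_tvDist (Matrix.vecMul μ (lazyWalk h)) (statDist h) H
      linarith
  refine le_trans ?_ hpt
  rw [edgeMean_sub, edgeMean_sub, edgeMean_const, edgeMean_const_mul, edgeMean_const_mul]
  have h11 : 4 / m ^ 2 * edgeMean (evolve p q g) (fun h => (edgeCount
      (⊤ : SimpleGraph V).edgeFinset h - m) ^ 2) ≤ 1 / 4 := by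
    calc _ ≤ 4 / m ^ 2 * m := by gcongr
      _ = 4 / m := by field_simp
      _ ≤ 1 / 4 := by rw [div_le_iff₀ (by linarith)]; linarith
  have h12 : 8 / m * edgeMean (evolve p q g) (fun h => ∑ v ∈ H, (h.degree v : ℝ)) ≤ 1 / 4 := by
    calc _ ≤ 8 / m * ((1 + C) * M * n / D) := by gcongr
      _ ≤ 8 / (a * n / 4) * ((1 + C) * M * n / D) := by gcongr
      _ = 32 * (1 + C) * M / (a * D) := by field_simp; ring
      _ ≤ 1 / 4 := by rw [div_le_iff₀ (by positivity)]; linarith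
  linarith

open Classical in
/-- One step from a graph with linearly bounded sum of squared degrees, and from any distribution
of the walk, leaves the walk far from stationarity with probability bounded below. -/
theorem exists_tvDist_ge_one_step {q₀ C a M : ℝ} (hq₀ : 0 < q₀) (hC : 0 ≤ C)
    (ha : 0 < a) (hM0 : 0 ≤ M) :
    ∃ δ > (0 : ℝ), ∃ c ∈ Set.Ioc (0 : ℝ) 1, ∃ N : ℕ, ∀ (n : ℕ), N ≤ n → ∀ (p q : ℝ),
      p ∈ Set.Icc (0 : ℝ) 1 → q ∈ Set.Icc (0 : ℝ) 1 → q₀ ≤ q → p * n ≤ C → a ≤ p * n →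
      ∀ (g : SimpleGraph (Fin n)), degSq g ≤ M * n →
      ∀ (μ : Fin n → ℝ), (∀ v, 0 ≤ μ v) → ∑ v, μ v = 1 →
      c ≤ edgeMean (evolve p q g) (fun h =>
        if δ ≤ tvDist (Matrix.vecMul μ (lazyWalk h)) (statDist h) then 1 else 0) := by
  obtain ⟨D, hD⟩ := exists_nat_ge (128 * (1 + C) * M / a + 1)
  have hD1 : (1 : ℝ) ≤ D := le_trans (by
    have : 0 ≤ 128 * (1 + C) * M / a := by positivity
    linarith) hD
  have hD2 : 128 * (1 + C) * M ≤ a * D := by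
    have : 128 * (1 + C) * M / a ≤ D := by linarith
    rwa [div_le_iff₀' ha] at this
  have hD0 : 0 < D := by exact_mod_cast (by linarith : (0 : ℝ) < D)
  obtain ⟨N, hN⟩ := exists_nat_ge (2 * (M + 1) + 64 / a + 2 * C)
  set κ := q₀ ^ D * Real.exp (-(2 * C)) with hκ
  have hκ0 : 0 < κ := by positivity
  refine ⟨min (κ / 8) (1 / 16), by positivity, min (κ / 4) (1 / 2),
    ⟨by positivity, (min_le_right _ _).trans (by norm_num)⟩, N, ?_⟩
  intro n hn p q hp hq hq₀q hpC hpa g hg μ hμ hμ1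
  have hNn : 2 * (M + 1) + 64 / a + 2 * C ≤ n := hN.trans (by exact_mod_cast hn)
  have ha' : 0 < 64 / a := by positivity
  have hcard : (Fintype.card (Fin n) : ℝ) = n := by simp
  have hw := evolve_mem_Icc hp hq g
  have hmono : ∀ δ, min (κ / 8) (1 / 16) ≤ δ →
      edgeMean (evolve p q g) (fun h =>
        if δ ≤ tvDist (Matrix.vecMul μ (lazyWalk h)) (statDist h) then 1 else 0) ≤
      edgeMean (evolve p q g) (fun h => if min (κ / 8) (1 / 16) ≤
        tvDist (Matrix.vecMul μ (lazyWalk h)) (statDist h) then 1 else 0) := by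
    intro δ hδ
    refine edgeMean_mono hw fun h => ?_
    split_ifs with h1 h2 h2
    · exact le_rfl
    · exact absurd (hδ.trans h1) h2
    · exact zero_le_one
    · exact le_rfl
  by_cases hlow : 1 / 2 ≤ ∑ v with g.degree v ≤ D, μ v
  · refine le_trans (min_le_left _ _) (le_trans ?_ (hmono (κ / 8) (min_le_left _ _)))
    have hp2 : p ≤ 1 / 2 := by
      have hn0 : (0 : ℝ) < n := by linarith
      have : p * n ≤ 1 / 2 * n := by linarith
      exact le_of_mul_le_mul_right this hn0
    exact tvDist_of_mass_on_low_degree hp hq hp2 hq₀ hq₀q (by rwa [hcard]) g D hμ hμ1 hlow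
  · refine le_trans (min_le_right _ _) (le_trans ?_ (hmono (1 / 16) (min_le_right _ _)))
    have hhigh : 1 / 2 ≤ ∑ v with D < g.degree v, μ v := by
      have := Finset.sum_filter_add_sum_filter_not Finset.univ (fun v => g.degree v ≤ D) μ
      simp only [not_le] at this
      push Not at hlow
      linarith
    refine tvDist_of_mass_on_high_degree (a := a) (M := M) (D := D) hp hq (by rwa [hcard]) ha
      (by rwa [hcard]) g (by rwa [hcard]) hD2 hD0 (by rw [hcard]; linarith) ?_ hμ hhigh
    rw [hcard, ← div_le_iff₀' ha]
    linarith

end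

/-! ### The Markov property along the random graph sequence -/

section

variable {V : Type*} [Fintype V] {Ω : Type*} [MeasurableSpace Ω] {P : Measure Ω}
  [IsProbabilityMeasure P] {G : ℕ → Ω → SimpleGraph V} {p q : ℝ}

instance : MeasurableSingletonClass (SimpleGraph V) where
  measurableSet_singleton g := by
    have h := SimpleGraph.measurable_edgeSet (V := V) (measurableSet_singleton g.edgeSet)
    convert h
    ext g'
    simp

/-- The path that follows `γ` up to time `t` and stays constant afterwards. -/
def extendPath (t : ℕ) (γ : Fin (t + 1) → SimpleGraph V) (i : ℕ) : SimpleGraph V :=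
  γ ⟨min i t, by omega⟩

theorem integral_eq_sum_of_finite {X : Type*} [Fintype X] [MeasurableSpace X]
    [MeasurableSingletonClass X] {Y : Ω → X} (hY : Measurable Y) (f : X → ℝ) :
    ∫ ω, f (Y ω) ∂P = ∑ x, P.real {ω | Y ω = x} * f x := by
  have hf : Measurable f := measurable_of_finite f
  rw [← integral_map (f := f) hY.aemeasurable hf.aestronglyMeasurable]
  have : IsProbabilityMeasure (P.map Y) := Measure.isProbabilityMeasure_map hY.aemeasurable
  rw [integral_fintype Integrable.of_finite]
  refine Finset.sum_congr rfl fun x _ => ?_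
  rw [map_measureReal_apply hY (measurableSet_singleton x), smul_eq_mul]
  rfl

omit [Fintype V] in
theorem measurable_history (hG : ∀ t, Measurable (G t)) (t : ℕ) :
    Measurable fun ω => fun i : Fin (t + 1) => G i ω :=
  measurable_pi_iff.2 fun i => hG i

omit [Fintype V] [MeasurableSpace Ω] in
theorem eq_extendPath_of_dependsOn {F : (ℕ → SimpleGraph V) → ℝ} {t : ℕ}
    (hF : DependsOn F (Set.Iic t)) (ω : Ω) :
    F (fun s => G s ω) = F (extendPath t fun i : Fin (t + 1) => G i ω) :=
  hF fun i hi => by simp [extendPath, min_eq_left (Set.mem_Iic.1 hi)]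

theorem integrable_of_dependsOn (hG : ∀ t, Measurable (G t)) {F : (ℕ → SimpleGraph V) → ℝ} {t : ℕ}
    (hF : DependsOn F (Set.Iic t)) : Integrable (fun ω => F fun s => G s ω) P := by
  classical
  have h1 : (fun ω => F fun s => G s ω) =
      (fun γ => F (extendPath t γ)) ∘ fun ω => fun i : Fin (t + 1) => G i ω := by
    ext ω
    exact eq_extendPath_of_dependsOn hF ω
  rw [h1]
  have : IsProbabilityMeasure (P.map fun ω => fun i : Fin (t + 1) => G i ω) :=
    Measure.isProbabilityMeasure_map (measurable_history hG t).aemeasurable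
  exact Integrable.comp_measurable Integrable.of_finite (measurable_history hG t)

/-- The Markov property: the graph at time `t + 1` is averaged over one step of the chain from the
graph at time `t`, independently of the history. -/
theorem integral_markov_step (hG : IsEdgeMarkovian P G p q) (t : ℕ)
    (F : (ℕ → SimpleGraph V) → SimpleGraph V → ℝ)
    (hF : ∀ h, DependsOn (fun g => F g h) (Set.Iic t)) :
    ∫ ω, F (fun s => G s ω) (G (t + 1) ω) ∂P =
      ∫ ω, edgeMean (evolve p q (G t ω)) (fun h => F (fun s => G s ω) h) ∂P := by
  classical
  have hY := (measurable_history hG.measurable t).prodMk (hG.measurable (t + 1))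
  have h1 : ∀ ω, F (fun s => G s ω) (G (t + 1) ω) =
      (fun y : (Fin (t + 1) → SimpleGraph V) × SimpleGraph V => F (extendPath t y.1) y.2)
        ((fun i : Fin (t + 1) => G i ω), G (t + 1) ω) := fun ω =>
    eq_extendPath_of_dependsOn (hF (G (t + 1) ω)) ω
  have h2 : ∀ ω, edgeMean (evolve p q (G t ω)) (fun h => F (fun s => G s ω) h) =
      (fun γ : Fin (t + 1) → SimpleGraph V =>
        edgeMean (evolve p q (γ (Fin.last t))) (fun h => F (extendPath t γ) h))
        (fun i : Fin (t + 1) => G i ω) := by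
    intro ω
    simp only [edgeMean, Fin.val_last]
    refine Finset.sum_congr rfl fun h _ => ?_
    rw [eq_extendPath_of_dependsOn (hF h) ω]
  have e1 := integral_eq_sum_of_finite (P := P) hY
    (fun y : (Fin (t + 1) → SimpleGraph V) × SimpleGraph V => F (extendPath t y.1) y.2)
  have e2 := integral_eq_sum_of_finite (P := P) (measurable_history hG.measurable t)
    (fun γ => edgeMean (evolve p q (γ (Fin.last t))) (fun h => F (extendPath t γ) h))
  rw [(integral_congr_ae (.of_forall h1)).trans e1, (integral_congr_ae (.of_forall h2)).trans e2,
    Fintype.sum_prod_type]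
  refine Finset.sum_congr rfl fun γ _ => ?_
  rw [edgeMean, Finset.mul_sum]
  refine Finset.sum_congr rfl fun h _ => ?_
  have h3 := hG.transition t (Function.update (extendPath t γ) (t + 1) h)
  have h4 : {ω | ((fun i : Fin (t + 1) => G i ω), G (t + 1) ω) = (γ, h)} =
      {ω | ∀ i ≤ t + 1, G i ω = Function.update (extendPath t γ) (t + 1) h i} := by
    ext ω
    simp only [Set.mem_ofPred_eq, Prod.mk.injEq, funext_iff]
    constructor
    · rintro ⟨ha, hb⟩ i hi
      rcases Nat.lt_or_ge i (t + 1) with hlt | hge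
      · rw [Function.update_of_ne (by omega)]
        have := ha ⟨i, hlt⟩
        simp only at this
        rw [this, extendPath]
        congr 1
        ext
        simp only
        omega
      · obtain rfl : i = t + 1 := by omega
        simpa using hb
    · intro ha
      refine ⟨fun i => ?_, by simpa using ha (t + 1) le_rfl⟩
      rw [ha i (by omega), Function.update_of_ne (by omega), extendPath]
      congr 1
      ext
      simp only
      omega
  have h5 : {ω | (fun i : Fin (t + 1) => G i ω) = γ} =
      {ω | ∀ i ≤ t, G i ω = Function.update (extendPath t γ) (t + 1) h i} := by
    ext ω
    simp only [Set.mem_ofPred_eq, funext_iff]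
    constructor
    · intro ha i hi
      rw [Function.update_of_ne (by omega)]
      have := ha ⟨i, by omega⟩
      simp only at this
      rw [this, extendPath]
      congr 1
      ext
      simp only
      omega
    · intro ha i
      rw [ha i (by omega), Function.update_of_ne (by omega), extendPath]
      congr 1
      ext
      simp only
      omega
  rw [h4, h5, h3, edgeTransProb_eq_edgeProd, Function.update_self,
    Function.update_of_ne (by omega), mul_assoc]
  congr 4
  · simp [extendPath, Fin.last]

/-- The drift inequality under a weight `φ` that depends on the graphs up to time `t`. -/
theorem integral_mul_degSq_step_le {C q₀ : ℝ} (hG : IsEdgeMarkovian P G p q) (hp : 0 ≤ p)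
    (hq₀ : 0 < q₀) (hq : q₀ ≤ q) (hq1 : q ≤ 1) (hpC : p * Fintype.card V ≤ C) {t : ℕ}
    {φ : (ℕ → SimpleGraph V) → ℝ} (hφ : DependsOn φ (Set.Iic t)) (hφ0 : ∀ g, 0 ≤ φ g) :
    ∫ ω, φ (fun s => G s ω) * degSq (G (t + 1) ω) ∂P ≤
      (1 - q₀) * ∫ ω, φ (fun s => G s ω) * degSq (G t ω) ∂P +
        driftConst C q₀ * Fintype.card V * ∫ ω, φ (fun s => G s ω) ∂P := by
  have h1 := integral_markov_step hG t (fun g h => φ g * degSq h)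
    fun h x y hxy => by simp only; rw [hφ hxy]
  have hdep : DependsOn (fun g : ℕ → SimpleGraph V => φ g * degSq (g t)) (Set.Iic t) :=
    fun x y hxy => by simp only; rw [hφ hxy, hxy t (Set.mem_Iic.2 le_rfl)]
  have hdep2 : DependsOn (fun g : ℕ → SimpleGraph V =>
      edgeMean (evolve p q (g t)) (fun h => φ g * degSq h)) (Set.Iic t) :=
    fun x y hxy => by simp only; rw [hφ hxy, hxy t (Set.mem_Iic.2 le_rfl)]
  have i1 := integrable_of_dependsOn (P := P) hG.measurable hdep
  have i2 := integrable_of_dependsOn (P := P) hG.measurable hφ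
  have i3 := integrable_of_dependsOn (P := P) hG.measurable hdep2
  rw [h1, ← integral_const_mul, ← integral_const_mul, ← integral_add (i1.const_mul _)
    (i2.const_mul _)]
  refine integral_mono i3 ((i1.const_mul _).add (i2.const_mul _)) fun ω => ?_
  beta_reduce
  rw [edgeMean_const_mul]
  nlinarith [mul_le_mul_of_nonneg_left (edgeMean_degSq_le hp hq₀ hq hq1 hpC (G t ω))
    (hφ0 fun s => G s ω)]

theorem integral_mul_degSq_le {C q₀ : ℝ} (hG : IsEdgeMarkovian P G p q) (hp : 0 ≤ p)
    (hq₀ : 0 < q₀) (hq : q₀ ≤ q) (hq1 : q ≤ 1) (hpC : p * Fintype.card V ≤ C) {t : ℕ}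
    {φ : (ℕ → SimpleGraph V) → ℝ} (hφ : DependsOn φ (Set.Iic t)) (hφ0 : ∀ g, 0 ≤ φ g) (k : ℕ) :
    ∫ ω, φ (fun s => G s ω) * degSq (G (t + k) ω) ∂P ≤
      (1 - q₀) ^ k * ∫ ω, φ (fun s => G s ω) * degSq (G t ω) ∂P +
        driftConst C q₀ / q₀ * Fintype.card V * ∫ ω, φ (fun s => G s ω) ∂P := by
  have hI : 0 ≤ ∫ ω, φ (fun s => G s ω) ∂P := integral_nonneg fun ω => hφ0 _
  have hC : 0 ≤ C := le_trans (by positivity) hpC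
  have hK := driftConst_nonneg hC hq₀
  induction k with
  | zero =>
    simp only [add_zero, pow_zero, one_mul, le_add_iff_nonneg_right]
    positivity
  | succ k ih =>
    have hφ' : DependsOn φ (Set.Iic (t + k)) :=
      fun x y hxy => hφ fun i hi => hxy i (Set.mem_Iic.2 (le_trans (Set.mem_Iic.1 hi) (by omega)))
    have h1 := integral_mul_degSq_step_le hG hp hq₀ hq hq1 hpC hφ' hφ0
    rw [← add_assoc]
    refine h1.trans ?_
    have h2 := mul_le_mul_of_nonneg_left ih (by linarith : 0 ≤ 1 - q₀)
    refine (add_le_add_left h2 _).trans (le_of_eq ?_)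
    field_simp
    ring

theorem walkDist_dependsOn (x : V) (t : ℕ) :
    DependsOn (fun g : ℕ → SimpleGraph V => walkDist g x t) (Set.Iic t) := by
  induction t with
  | zero => intro g g' _; rfl
  | succ t ih =>
    intro g g' h
    simp only [walkDist]
    rw [h (t + 1) (Set.mem_Iic.2 le_rfl)]
    have := ih (x := g) (y := g') fun i hi => h i (Set.mem_Iic.2 (by
      have := Set.mem_Iic.1 hi; omega))
    simp only at this
    rw [this]

open Classical in
/-- The indicator that at time `t` the walk started at `x` is closer than `δ` to stationarity. -/
noncomputable def closeInd (δ : ℝ) (x : V) (t : ℕ) (g : ℕ → SimpleGraph V) : ℝ :=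
  if δ ≤ tvDist (walkDist g x t) (statDist (g t)) then 0 else 1

theorem closeInd_nonneg (δ : ℝ) (x : V) (t : ℕ) (g : ℕ → SimpleGraph V) :
    0 ≤ closeInd δ x t g := by
  unfold closeInd; split_ifs <;> norm_num

theorem closeInd_dependsOn (δ : ℝ) (x : V) (t : ℕ) : DependsOn (closeInd δ x t) (Set.Iic t) := by
  intro g g' h
  have h1 := walkDist_dependsOn x t h
  simp only at h1
  unfold closeInd
  rw [h1, h t (Set.mem_Iic.2 le_rfl)]

open Classical in
/-- If one step from every graph with `degSq` at most `B` leaves the walk far from stationarity with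
probability at least `c`, then the weight of being close at time `t + 1` drops by `c` times the
weight of such graphs. -/
theorem integral_mul_closeInd_le {δ c B : ℝ} (hp : p ∈ Set.Icc (0 : ℝ) 1)
    (hq : q ∈ Set.Icc (0 : ℝ) 1) (hG : IsEdgeMarkovian P G p q)
    (hstep : ∀ g : SimpleGraph V, degSq g ≤ B →
      ∀ μ : V → ℝ, (∀ v, 0 ≤ μ v) → ∑ v, μ v = 1 →
      c ≤ edgeMean (evolve p q g) (fun h =>
        if δ ≤ tvDist (Matrix.vecMul μ (lazyWalk h)) (statDist h) then 1 else 0))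
    (x : V) {t : ℕ} {φ : (ℕ → SimpleGraph V) → ℝ} (hφ : DependsOn φ (Set.Iic t))
    (hφ0 : ∀ g, 0 ≤ φ g) :
    ∫ ω, φ (fun s => G s ω) * closeInd δ x (t + 1) (fun s => G s ω) ∂P ≤
      ∫ ω, φ (fun s => G s ω) ∂P -
        c * ∫ ω, φ (fun s => G s ω) * (if degSq (G t ω) ≤ B then 1 else 0) ∂P := by
  set F : (ℕ → SimpleGraph V) → SimpleGraph V → ℝ := fun g h => φ g *
    (if δ ≤ tvDist (Matrix.vecMul (walkDist g x t) (lazyWalk h)) (statDist h) then 0 else 1)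
    with hF
  have hFdep : ∀ h, DependsOn (fun g => F g h) (Set.Iic t) := by
    intro h g g' hg
    have h1 := walkDist_dependsOn x t hg
    simp only at h1
    simp only [hF]
    rw [hφ hg, h1]
  have h1 := integral_markov_step hG t F hFdep
  have h2 : ∫ ω, φ (fun s => G s ω) * closeInd δ x (t + 1) (fun s => G s ω) ∂P =
      ∫ ω, F (fun s => G s ω) (G (t + 1) ω) ∂P := rfl
  have hdep : DependsOn (fun g : ℕ → SimpleGraph V => φ g *
      (if degSq (g t) ≤ B then 1 else 0)) (Set.Iic t) :=
    fun x y hxy => by simp only; rw [hφ hxy, hxy t (Set.mem_Iic.2 le_rfl)]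
  have hdep2 : DependsOn (fun g : ℕ → SimpleGraph V =>
      edgeMean (evolve p q (g t)) (fun h => F g h)) (Set.Iic t) := by
    intro g g' hg
    have : ∀ h, F g h = F g' h := fun h => hFdep h hg
    simp only [this]
    rw [hg t (Set.mem_Iic.2 le_rfl)]
  have i1 := integrable_of_dependsOn (P := P) hG.measurable hdep
  have i2 := integrable_of_dependsOn (P := P) hG.measurable hφ
  have i3 := integrable_of_dependsOn (P := P) hG.measurable hdep2
  rw [h2, h1, ← integral_const_mul, ← integral_sub i2 (i1.const_mul _)]
  refine integral_mono i3 (i2.sub (i1.const_mul _)) fun ω => ?_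
  simp only [hF]
  rw [edgeMean_const_mul]
  set g : ℕ → SimpleGraph V := fun s => G s ω with hg
  have hw := evolve_mem_Icc hp hq (G t ω)
  set f : SimpleGraph V → ℝ := fun h => if δ ≤ tvDist (Matrix.vecMul (walkDist g x t)
    (lazyWalk h)) (statDist h) then 1 else 0 with hf
  have h3 : (fun h => if δ ≤ tvDist (Matrix.vecMul (walkDist g x t) (lazyWalk h)) (statDist h)
      then (0 : ℝ) else 1) = fun h => 1 - f h := by
    ext h
    simp only [hf]
    split_ifs <;> norm_num
  rw [h3, edgeMean_sub, edgeMean_one]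
  have h4 : c * (if degSq (G t ω) ≤ B then 1 else 0) ≤ edgeMean (evolve p q (G t ω)) f := by
    split_ifs with hB
    · rw [mul_one]
      exact hstep _ hB _ (walkDist_nonneg g x t) (sum_walkDist g x t)
    · rw [mul_zero, ← edgeMean_const (evolve p q (G t ω)) 0]
      refine edgeMean_mono hw fun h => ?_
      simp only [hf]
      split_ifs <;> norm_num
  nlinarith [mul_le_mul_of_nonneg_left h4 (hφ0 g)]

end

/-! ### Blocks and windows -/

open Classical in
/-- Markov's inequality for `degSq` under the weight `φ`. -/
theorem half_integral_le_integral_typical {V : Type*} [Fintype V] {Ω : Type*} [MeasurableSpace Ω]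
    {P : Measure Ω} [IsProbabilityMeasure P] {G : ℕ → Ω → SimpleGraph V}
    (hG : ∀ t, Measurable (G t)) {t : ℕ} {φ : (ℕ → SimpleGraph V) → ℝ}
    (hφ : DependsOn φ (Set.Iic t)) (hφ0 : ∀ g, 0 ≤ φ g) {B : ℝ} (hB : 0 < B)
    (hle : ∫ ω, φ (fun s => G s ω) * degSq (G t ω) ∂P ≤ B / 2 * ∫ ω, φ (fun s => G s ω) ∂P) :
    (∫ ω, φ (fun s => G s ω) ∂P) / 2 ≤
      ∫ ω, φ (fun s => G s ω) * (if degSq (G t ω) ≤ B then 1 else 0) ∂P := by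
  have hdep : DependsOn (fun g : ℕ → SimpleGraph V => φ g *
      (if degSq (g t) ≤ B then 1 else 0)) (Set.Iic t) :=
    fun x y hxy => by simp only; rw [hφ hxy, hxy t (Set.mem_Iic.2 le_rfl)]
  have hdep2 : DependsOn (fun g : ℕ → SimpleGraph V => φ g * degSq (g t)) (Set.Iic t) :=
    fun x y hxy => by simp only; rw [hφ hxy, hxy t (Set.mem_Iic.2 le_rfl)]
  have i1 := integrable_of_dependsOn (P := P) hG hdep
  have i2 := integrable_of_dependsOn (P := P) hG hφ
  have i3 := integrable_of_dependsOn (P := P) hG hdep2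
  have h1 : ∫ ω, φ (fun s => G s ω) ∂P ≤ ∫ ω, (φ (fun s => G s ω) *
      (if degSq (G t ω) ≤ B then 1 else 0) + B⁻¹ * (φ (fun s => G s ω) * degSq (G t ω))) ∂P := by
    refine integral_mono i2 (i1.add (i3.const_mul _)) fun ω => ?_
    beta_reduce
    have h2 := hφ0 fun s => G s ω
    have h3 := degSq_nonneg (G t ω)
    split_ifs with hc
    · have : 0 ≤ B⁻¹ * (φ (fun s => G s ω) * degSq (G t ω)) := by positivity
      linarith
    · push Not at hc
      have h4 : 1 ≤ B⁻¹ * degSq (G t ω) := by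
        rw [inv_mul_eq_div, one_le_div hB]; exact hc.le
      nlinarith
  rw [integral_add i1 (i3.const_mul _), integral_const_mul] at h1
  have h5 : B⁻¹ * ∫ ω, φ (fun s => G s ω) * degSq (G t ω) ∂P ≤
      B⁻¹ * (B / 2 * ∫ ω, φ (fun s => G s ω) ∂P) := by gcongr
  have h6 : B⁻¹ * (B / 2 * ∫ ω, φ (fun s => G s ω) ∂P) = (∫ ω, φ (fun s => G s ω) ∂P) / 2 := by
    field_simp
  linarith

/-- The bound, per vertex, for the sum of squared degrees of a typical graph. -/
noncomputable def typicalBound (C q₀ : ℝ) : ℝ :=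
  2 * (1 + driftConst C q₀ + driftConst C q₀ / q₀)

open Classical in
/-- The edge-Markovian chain on `n` vertices is sparse and fast-changing, with constants `q₀`
and `C`, and one step from a typical graph leaves the walk `δ`-far from stationarity with
probability at least `c`. -/
structure SparseFast (q₀ C δ c : ℝ) (n : ℕ) (p q : ℝ) : Prop where
  hp : p ∈ Set.Icc (0 : ℝ) 1
  hq : q ∈ Set.Icc (0 : ℝ) 1
  hn : 0 < n
  hq₀ : 0 < q₀
  hqq : q₀ ≤ q
  hpC : p * n ≤ C
  hc : c ∈ Set.Ioc (0 : ℝ) 1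
  hstep : ∀ g : SimpleGraph (Fin n), degSq g ≤ typicalBound C q₀ * n →
    ∀ μ : Fin n → ℝ, (∀ v, 0 ≤ μ v) → ∑ v, μ v = 1 →
    c ≤ edgeMean (evolve p q g) (fun h =>
      if δ ≤ tvDist (Matrix.vecMul μ (lazyWalk h)) (statDist h) then 1 else 0)

section

variable {q₀ C δ c p q : ℝ} {n : ℕ} {Ω : Type*} [MeasurableSpace Ω] {P : Measure Ω}
  [IsProbabilityMeasure P] {G : ℕ → Ω → SimpleGraph (Fin n)}

theorem SparseFast.driftConst_nonneg (h : SparseFast q₀ C δ c n p q) : 0 ≤ driftConst C q₀ :=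
  DynGraph.driftConst_nonneg
    (le_trans (mul_nonneg h.hp.1 (Nat.cast_nonneg n)) h.hpC) h.hq₀

theorem SparseFast.typicalBound_pos (h : SparseFast q₀ C δ c n p q) : 0 < typicalBound C q₀ := by
  have h1 := h.driftConst_nonneg
  have h2 : 0 ≤ driftConst C q₀ / q₀ := div_nonneg h1 h.hq₀.le
  unfold typicalBound
  linarith

/-- One step loses the proportion `c / 2` of any weight that depends on the past and under which
the current graph has linear `degSq` on average. -/
theorem SparseFast.integral_mul_closeInd_le (h : SparseFast q₀ C δ c n p q)
    (hG : IsEdgeMarkovian P G p q) (x : Fin n) {t : ℕ} {φ : (ℕ → SimpleGraph (Fin n)) → ℝ}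
    (hφ : DependsOn φ (Set.Iic t)) (hφ0 : ∀ g, 0 ≤ φ g)
    (hle : ∫ ω, φ (fun s => G s ω) * degSq (G t ω) ∂P ≤
      typicalBound C q₀ * n / 2 * ∫ ω, φ (fun s => G s ω) ∂P) :
    ∫ ω, φ (fun s => G s ω) * closeInd δ x (t + 1) (fun s => G s ω) ∂P ≤
      (1 - c / 2) * ∫ ω, φ (fun s => G s ω) ∂P := by
  have hB : 0 < typicalBound C q₀ * n :=
    mul_pos h.typicalBound_pos (by exact_mod_cast h.hn)
  have h1 := DynGraph.integral_mul_closeInd_le h.hp h.hq hG h.hstep x hφ hφ0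
  have h2 := half_integral_le_integral_typical hG.measurable hφ hφ0 hB hle
  nlinarith [h.hc.1]

/-- After a burn-in of `k` steps from an arbitrary graph, one further step loses a fixed proportion
of any weight that depends on the past. -/
theorem SparseFast.integral_mul_closeInd_le_of_burnIn (h : SparseFast q₀ C δ c n p q)
    (hG : IsEdgeMarkovian P G p q) (x : Fin n) {t k : ℕ}
    (hk : (n : ℝ) ^ 2 * (1 - q₀) ^ k ≤ 1) {φ : (ℕ → SimpleGraph (Fin n)) → ℝ}
    (hφ : DependsOn φ (Set.Iic t)) (hφ0 : ∀ g, 0 ≤ φ g) :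
    ∫ ω, φ (fun s => G s ω) * closeInd δ x (t + k + 1) (fun s => G s ω) ∂P ≤
      (1 - c / 2) * ∫ ω, φ (fun s => G s ω) ∂P := by
  have hφ' : DependsOn φ (Set.Iic (t + k)) :=
    fun x y hxy => hφ fun i hi => hxy i (Set.mem_Iic.2 (le_trans (Set.mem_Iic.1 hi) (by omega)))
  refine h.integral_mul_closeInd_le hG x hφ' hφ0 ?_
  have hI : 0 ≤ ∫ ω, φ (fun s => G s ω) ∂P := integral_nonneg fun ω => hφ0 _
  have h1 := integral_mul_degSq_le (C := C) hG h.hp.1 h.hq₀ h.hqq h.hq.2 (by simpa using h.hpC)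
    hφ hφ0 k
  have hdep : DependsOn (fun g : ℕ → SimpleGraph (Fin n) => φ g * degSq (g t)) (Set.Iic t) :=
    fun x y hxy => by simp only; rw [hφ hxy, hxy t (Set.mem_Iic.2 le_rfl)]
  have h2 : ∫ ω, φ (fun s => G s ω) * degSq (G t ω) ∂P ≤
      (n : ℝ) ^ 3 * ∫ ω, φ (fun s => G s ω) ∂P := by
    rw [← integral_const_mul]
    refine integral_mono (integrable_of_dependsOn (P := P) hG.measurable hdep)
      ((integrable_of_dependsOn (P := P) hG.measurable hφ).const_mul _) fun ω => ?_
    have h3 := degSq_le (G t ω)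
    rw [Fintype.card_fin] at h3
    beta_reduce
    nlinarith [mul_le_mul_of_nonneg_left h3 (hφ0 fun s => G s ω)]
  have hr : 0 ≤ (1 - q₀) ^ k := pow_nonneg (by linarith [h.hqq, h.hq.2]) k
  have hn0 : (0 : ℝ) ≤ n := Nat.cast_nonneg n
  have h4 : (1 - q₀) ^ k * ∫ ω, φ (fun s => G s ω) * degSq (G t ω) ∂P ≤
      n * ∫ ω, φ (fun s => G s ω) ∂P := by
    calc _ ≤ (1 - q₀) ^ k * ((n : ℝ) ^ 3 * ∫ ω, φ (fun s => G s ω) ∂P) := by gcongr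
      _ = ((n : ℝ) ^ 2 * (1 - q₀) ^ k) * (n * ∫ ω, φ (fun s => G s ω) ∂P) := by ring
      _ ≤ 1 * (n * ∫ ω, φ (fun s => G s ω) ∂P) := by gcongr
      _ = _ := one_mul _
  rw [Fintype.card_fin] at h1
  have h5 : typicalBound C q₀ * n / 2 * ∫ ω, φ (fun s => G s ω) ∂P =
      n * ∫ ω, φ (fun s => G s ω) ∂P + driftConst C q₀ * (n * ∫ ω, φ (fun s => G s ω) ∂P) +
      driftConst C q₀ / q₀ * n * ∫ ω, φ (fun s => G s ω) ∂P := by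
    unfold typicalBound; ring
  have h6 : 0 ≤ driftConst C q₀ * (n * ∫ ω, φ (fun s => G s ω) ∂P) :=
    mul_nonneg h.driftConst_nonneg (mul_nonneg hn0 hI)
  linarith

/-- The probability of being close to stationarity at the ends of `m` consecutive blocks of length
`k + 1` decays exponentially in `m`. -/
theorem SparseFast.integral_prod_closeInd_le (h : SparseFast q₀ C δ c n p q)
    (hG : IsEdgeMarkovian P G p q) (x : Fin n) (t : ℕ) {k : ℕ}
    (hk : (n : ℝ) ^ 2 * (1 - q₀) ^ k ≤ 1) (m : ℕ) :
    ∫ ω, ∏ j ∈ Finset.range m, closeInd δ x (t + (j + 1) * (k + 1)) (fun s => G s ω) ∂P ≤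
      (1 - c / 2) ^ m := by
  induction m with
  | zero => simp
  | succ m ih =>
    have hφ : DependsOn (fun g : ℕ → SimpleGraph (Fin n) =>
        ∏ j ∈ Finset.range m, closeInd δ x (t + (j + 1) * (k + 1)) g)
        (Set.Iic (t + m * (k + 1))) := by
      intro g g' hg
      refine Finset.prod_congr rfl fun j hj => closeInd_dependsOn δ x _ fun i hi => hg i ?_
      rw [Finset.mem_range] at hj
      rw [Set.mem_Iic] at hi ⊢
      refine hi.trans ?_
      gcongr
      omega
    have h1 := h.integral_mul_closeInd_le_of_burnIn hG x hk hφ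
      fun g => Finset.prod_nonneg fun j _ => closeInd_nonneg δ x _ g
    have h2 : t + m * (k + 1) + k + 1 = t + (m + 1) * (k + 1) := by ring
    rw [h2] at h1
    simp_rw [Finset.prod_range_succ, pow_succ']
    exact h1.trans (mul_le_mul_of_nonneg_left ih (by linarith [h.hc.2]))

/-- A window of length `√n` contains `k + 1` blocks of length `k + 1`, so the probability of being
mixed throughout it is exponentially small in `k`, uniformly in the starting time and the past. -/
theorem SparseFast.prob_isMixedFrom_le (h : SparseFast q₀ C δ c n p q)
    (hG : IsEdgeMarkovian P G p q) {ε : ℝ} (hε : ε < δ) (t : ℕ) {k : ℕ}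
    (hk : (n : ℝ) ^ 2 * (1 - q₀) ^ k ≤ 1) (hkn : (((k + 1) * (k + 1) : ℕ) : ℝ) ≤ Real.sqrt n) :
    P.real {ω | IsMixedFrom ε (fun s => G s ω) t} ≤ (1 - c / 2) ^ (k + 1) := by
  set x : Fin n := ⟨0, h.hn⟩
  set Φ : (ℕ → SimpleGraph (Fin n)) → ℝ := fun g =>
    ∏ j ∈ Finset.range (k + 1), closeInd δ x (t + (j + 1) * (k + 1)) g with hΦ
  have hΦ0 : ∀ g, 0 ≤ Φ g := fun g => Finset.prod_nonneg fun j _ => closeInd_nonneg δ x _ g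
  have hdep : DependsOn Φ (Set.Iic (t + (k + 1) * (k + 1))) := by
    intro g g' hg
    refine Finset.prod_congr rfl fun j hj => closeInd_dependsOn δ x _ fun i hi => hg i ?_
    rw [Finset.mem_range] at hj
    rw [Set.mem_Iic] at hi ⊢
    refine hi.trans ?_
    gcongr
    omega
  have h1 := mul_meas_ge_le_integral_of_nonneg (μ := P) (f := fun ω => Φ fun s => G s ω)
    (.of_forall fun ω => hΦ0 _) (integrable_of_dependsOn hG.measurable hdep) 1
  rw [one_mul] at h1
  refine le_trans (measureReal_mono ?_) (h1.trans (h.integral_prod_closeInd_le hG x t hk (k + 1)))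
  intro ω hω
  have h2 : Φ (fun s => G s ω) = 1 := by
    refine Finset.prod_eq_one fun j hj => ?_
    rw [Finset.mem_range] at hj
    have h3 : ((t + (j + 1) * (k + 1) : ℕ) : ℝ) ≤ t + Real.sqrt (Fintype.card (Fin n)) := by
      rw [Fintype.card_fin, Nat.cast_add]
      have : (((j + 1) * (k + 1) : ℕ) : ℝ) ≤ ((k + 1) * (k + 1) : ℕ) := by
        exact_mod_cast Nat.mul_le_mul_right _ (by omega)
      linarith
    have h4 := (show IsMixedFrom ε (fun s => G s ω) t from hω) _ (Nat.le_add_right _ _) h3 x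
    unfold closeInd
    rw [if_neg (by linarith)]
  exact h2.ge

/-- With a sparse initial graph no burn-in is needed, so that the walk is far from stationarity with
probability bounded below at every single positive time. -/
theorem SparseFast.prob_far_succ_ge (h : SparseFast q₀ C δ c n p q)
    (hG : IsEdgeMarkovian P G p q)
    (h0 : ∫ ω, degSq (G 0 ω) ∂P ≤ driftConst C q₀ * n) (x : Fin n) (t : ℕ) :
    c / 2 ≤ P.real {ω | δ ≤ tvDist (walkDist (fun s => G s ω) x (t + 1))
      (statDist (G (t + 1) ω))} := by
  have hdep1 : DependsOn (fun _ : ℕ → SimpleGraph (Fin n) => (1 : ℝ)) (Set.Iic 0) :=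
    fun _ _ _ => rfl
  have hdep : DependsOn (fun _ : ℕ → SimpleGraph (Fin n) => (1 : ℝ)) (Set.Iic t) :=
    fun _ _ _ => rfl
  have h1 := integral_mul_degSq_le (C := C) hG h.hp.1 h.hq₀ h.hqq h.hq.2 (by simpa using h.hpC)
    hdep1 (fun _ => zero_le_one) t
  have h2 : ∫ ω, (1 : ℝ) * degSq (G t ω) ∂P ≤ typicalBound C q₀ * n / 2 * ∫ _, (1 : ℝ) ∂P := by
    simp only [one_mul, integral_const, probReal_univ, smul_eq_mul, mul_one, zero_add,
      Fintype.card_fin] at h1 ⊢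
    have hr : (1 - q₀) ^ t ≤ 1 :=
      pow_le_one₀ (by linarith [h.hqq, h.hq.2]) (by linarith [h.hq₀])
    have hI : 0 ≤ ∫ ω, degSq (G 0 ω) ∂P := integral_nonneg fun ω => degSq_nonneg _
    have h5 : typicalBound C q₀ * n / 2 =
        n + driftConst C q₀ * n + driftConst C q₀ / q₀ * n := by
      unfold typicalBound; ring
    have hn0 : (0 : ℝ) ≤ n := Nat.cast_nonneg n
    nlinarith
  have h3 := h.integral_mul_closeInd_le hG x hdep (fun _ => zero_le_one) h2
  simp only [one_mul, integral_const, probReal_univ, smul_eq_mul, mul_one] at h3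
  have h4 := mul_meas_ge_le_integral_of_nonneg (μ := P)
    (f := fun ω => closeInd δ x (t + 1) fun s => G s ω)
    (.of_forall fun ω => closeInd_nonneg _ _ _ _)
    (integrable_of_dependsOn hG.measurable (closeInd_dependsOn δ x (t + 1))) 1
  rw [one_mul] at h4
  have h5 : (Set.univ : Set Ω) ⊆
      {ω | δ ≤ tvDist (walkDist (fun s => G s ω) x (t + 1)) (statDist (G (t + 1) ω))} ∪
      {ω | 1 ≤ closeInd δ x (t + 1) fun s => G s ω} := by
    intro ω _
    by_cases hc : δ ≤ tvDist (walkDist (fun s => G s ω) x (t + 1)) (statDist (G (t + 1) ω))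
    · exact Or.inl hc
    · right
      simp only [Set.mem_ofPred_eq, closeInd]
      rw [if_neg hc]
  have h6 := (measureReal_mono (μ := P) h5).trans (measureReal_union_le _ _)
  rw [probReal_univ] at h6
  linarith

end

/-- At time `0` all mass sits on `x`, while an edge at `x` has another endpoint, so that `x` has
stationary probability at most `1 / 2`. -/
theorem quarter_le_tvDist_zero {V : Type*} [Fintype V] (g : ℕ → SimpleGraph V) (x : V) :
    1 / 4 ≤ tvDist (walkDist g x 0) (statDist (g 0)) := by
  classical
  have h1 := half_sub_le_tvDist (walkDist g x 0) (statDist (g 0)) {x}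
  have h2 : walkDist g x 0 x = 1 := by simp [walkDist]
  have h3 : statDist (g 0) x ≤ 1 / 2 := by
    unfold statDist
    refine div_le_of_le_mul₀ (by positivity) (by norm_num) ?_
    have : ((g 0).degree x : ℝ) ≤ ((g 0).edgeFinset.card : ℝ) := by
      rw [← SimpleGraph.card_incidenceFinset_eq_degree]
      exact_mod_cast Finset.card_le_card ((g 0).incidenceFinset_subset x)
    convert (show ((g 0).degree x : ℝ) ≤ 1 / 2 * (2 * ((g 0).edgeFinset.card : ℝ)) by linarith)
  rw [Finset.sum_singleton, Finset.sum_singleton, h2] at h1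
  linarith

/-! ### The stationary initial graph -/

theorem binomialRandom_real_singleton {V : Type*} [Fintype V] (r : unitInterval)
    (g : SimpleGraph V) :
    (SimpleGraph.binomialRandom V r).real {g} = edgeProd (fun _ => (r : ℝ)) g := by
  classical
  have hsub : g.edgeFinset ⊆ (⊤ : SimpleGraph V).edgeFinset :=
    SimpleGraph.edgeFinset_mono (le_top : g ≤ ⊤)
  have hf : (⊤ : SimpleGraph V).edgeFinset.filter (fun e => e ∈ g.edgeSet) = g.edgeFinset := by
    ext e
    simp only [Finset.mem_filter, SimpleGraph.mem_edgeFinset]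
    exact ⟨fun h => h.2, fun he => ⟨SimpleGraph.edgeSet_mono le_top he, he⟩⟩
  have hf' : (⊤ : SimpleGraph V).edgeFinset.filter (fun e => e ∉ g.edgeSet) =
      (⊤ : SimpleGraph V).edgeFinset \ g.edgeFinset := by
    ext e
    simp
  have hprod : edgeProd (fun _ => (r : ℝ)) g = (r : ℝ) ^ g.edgeFinset.card *
      (1 - (r : ℝ)) ^ ((Fintype.card V).choose 2 - g.edgeFinset.card) := by
    have : edgeProd (fun _ => (r : ℝ)) g = ∏ e ∈ (⊤ : SimpleGraph V).edgeFinset,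
        if e ∈ g.edgeSet then (r : ℝ) else 1 - r := by
      unfold edgeProd; congr!
    rw [this, Finset.prod_ite, Finset.prod_const, Finset.prod_const, hf, hf',
      Finset.card_sdiff_of_subset hsub, SimpleGraph.card_edgeFinset_top_eq_card_choose_two]
  rw [hprod, measureReal_def, SimpleGraph.binomialRandom_singleton]
  simp [← SimpleGraph.coe_edgeFinset, Set.ncard_coe_finset]

/-- The stationary graph is what one step of a chain with birth probability `p / (p + q)` makes of
the empty graph, so that the drift inequality bounds its `degSq`. -/
theorem integral_degSq_le_of_hasLaw {q₀ C p q : ℝ} {V : Type*} [Fintype V]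
    {Ω : Type*} [MeasurableSpace Ω] {P : Measure Ω} [IsProbabilityMeasure P] {X : Ω → SimpleGraph V}
    (hp : 0 ≤ p) (hq₀ : 0 < q₀) (hqq : q₀ ≤ q) (hq1 : q ≤ 1) (hpC : p / q₀ * Fintype.card V ≤ C)
    (hX : HasLaw X (SimpleGraph.binomialRandom V (stationaryEdgeProb p q)) P) :
    ∫ ω, degSq (X ω) ∂P ≤ driftConst C q₀ * Fintype.card V := by
  have hr : ((stationaryEdgeProb p q : unitInterval) : ℝ) = p / (p + q) := by
    unfold stationaryEdgeProb
    rw [Set.projIcc_of_mem]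
    exact ⟨div_nonneg hp (by linarith), (div_le_one (by linarith)).2 (by linarith)⟩
  set r := stationaryEdgeProb p q
  have h1 : ∫ ω, degSq (X ω) ∂P = edgeMean (fun _ : Sym2 V => (r : ℝ)) degSq := by
    classical
    have := hX.integral_comp (f := degSq) (measurable_of_finite _).aestronglyMeasurable
    simp only [Function.comp_def] at this
    rw [this, integral_fintype Integrable.of_finite]
    simp only [binomialRandom_real_singleton, smul_eq_mul]
    unfold edgeMean
    congr!
  have h2 : (fun _ : Sym2 V => (r : ℝ)) = evolve (r : ℝ) q (⊥ : SimpleGraph V) := by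
    ext e
    simp [evolve]
  have h3 : (r : ℝ) * Fintype.card V ≤ C := by
    rw [hr]
    refine le_trans ?_ hpC
    gcongr
    linarith
  have h4 : degSq (⊥ : SimpleGraph V) = 0 := by
    simp [degSq]
  have h5 := edgeMean_degSq_le r.2.1 hq₀ hqq hq1 h3 (⊥ : SimpleGraph V)
  rw [h4, mul_zero, zero_add] at h5
  rw [h1, h2]
  exact h5

/-! ### Asymptotics -/

/-- Any power of `n` is negligible against an exponential in `n ^ (1 / 4)`. -/
theorem eventually_pow_mul_pow_le {r A : ℝ} (hr0 : 0 ≤ r) (hr1 : r < 1) (hA : 0 < A) (k : ℕ) :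
    ∀ᶠ n : ℕ in atTop, (n : ℝ) ^ k * r ^ (Nat.sqrt (Nat.sqrt n) - 1) ≤ A := by
  have hsq : Tendsto Nat.sqrt atTop atTop :=
    tendsto_atTop.2 fun b => eventually_atTop.2 ⟨b * b, fun n hn => Nat.le_sqrt.2 hn⟩
  have hL : Tendsto (fun n : ℕ => Nat.sqrt (Nat.sqrt n) - 1) atTop atTop :=
    (tendsto_sub_atTop_nat 1).comp (hsq.comp hsq)
  have h1 := tendsto_pow_const_mul_const_pow_of_abs_lt_one (4 * k)
    (abs_lt.2 ⟨by linarith, hr1⟩ : |r| < 1)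
  have h2 := (h1.const_mul ((3 : ℝ) ^ (4 * k))).comp hL
  rw [mul_zero] at h2
  filter_upwards [h2.eventually_le_const hA, hL.eventually_ge_atTop 1] with n hn hn1
  refine le_trans ?_ hn
  simp only [Function.comp_apply]
  set l := Nat.sqrt (Nat.sqrt n) - 1 with hl
  have h3 : n ≤ (3 * l) ^ 4 := by
    have h4 := Nat.lt_succ_sqrt n
    have h5 := Nat.lt_succ_sqrt (Nat.sqrt n)
    have h6 : Nat.sqrt (Nat.sqrt n) + 1 ≤ 3 * l := by omega
    calc n ≤ (Nat.sqrt n + 1) * (Nat.sqrt n + 1) := h4.le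
      _ ≤ ((Nat.sqrt (Nat.sqrt n) + 1) * (Nat.sqrt (Nat.sqrt n) + 1)) *
          ((Nat.sqrt (Nat.sqrt n) + 1) * (Nat.sqrt (Nat.sqrt n) + 1)) :=
          Nat.mul_le_mul h5 h5
      _ ≤ ((3 * l) * (3 * l)) * ((3 * l) * (3 * l)) := by gcongr
      _ = (3 * l) ^ 4 := by ring
  have h7 : (n : ℝ) ≤ (3 * l) ^ 4 := by exact_mod_cast h3
  calc (n : ℝ) ^ k * r ^ l ≤ ((3 * (l : ℝ)) ^ 4) ^ k * r ^ l := by gcongr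
    _ = _ := by rw [← pow_mul, mul_pow]; ring

/-- A finite bound on an infimum of the form of the mixing times is witnessed by an admissible
time. -/
theorem exists_le_of_iInf_le {Q : ℕ → Prop} {N : ℕ}
    (h : (⨅ (t : ℕ) (_ : Q t), (t : ℕ∞)) ≤ N) : ∃ t ≤ N, Q t := by
  have h1 : (⨅ (t : ℕ) (_ : Q t), (t : ℕ∞)) < ((N + 1 : ℕ) : ℕ∞) :=
    lt_of_le_of_lt h (by exact_mod_cast Nat.lt_succ_self N)
  obtain ⟨t, ht⟩ := iInf_lt_iff.1 h1
  obtain ⟨hQ, ht'⟩ := iInf_lt_iff.1 ht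
  exact ⟨t, Nat.lt_succ_iff.1 (by exact_mod_cast ht'), hQ⟩

end DynGraph

open DynGraph in
theorem theorem1 (p q : ℕ → ℝ)
    (hp01 : ∀ n, p n ∈ Set.Icc (0 : ℝ) 1) (hq01 : ∀ n, q n ∈ Set.Icc (0 : ℝ) 1)
    (hp : p =Θ[atTop] fun n : ℕ => 1 / (n : ℝ))
    (hq : (fun _ : ℕ => (1 : ℝ)) =O[atTop] q)
    (Ω : ℕ → Type*) [∀ n, MeasurableSpace (Ω n)]
    (P : ∀ n, Measure (Ω n)) [∀ n, IsProbabilityMeasure (P n)]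
    (G : ∀ n, ℕ → Ω n → SimpleGraph (Fin n))
    (hG : ∀ n, IsEdgeMarkovian (P n) (G n) (p n) (q n)) :
    (∀ ε η : ℕ → ℝ, Tendsto ε atTop (𝓝 0) → Tendsto η atTop (𝓝 0) →
      ∀ᶠ n in atTop, modelMixingTime (P n) (G n) (ε n) (η n) = ⊤) ∧
    (∀ ε η : ℕ → ℝ, Tendsto ε atTop (𝓝 0) → Tendsto η atTop (𝓝 0) →
      ∀ k : ℕ, ∀ᶠ n : ℕ in atTop,
        ((n ^ k : ℕ) : ℕ∞) < modelHittingMixingTime (P n) (G n) (ε n) (η n)) ∧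
    ((∀ n, HasLaw (G n 0)
        (SimpleGraph.binomialRandom (Fin n) (stationaryEdgeProb (p n) (q n))) (P n)) →
      ∃ δ > (0 : ℝ), ∃ c > (0 : ℝ), ∀ᶠ n in atTop, ∀ (t : ℕ) (x : Fin n),
        c ≤ (P n).real
          {ω | δ ≤ tvDist (walkDist (fun s => G n s ω) x t) (statDist (G n t ω))}) := by
  obtain ⟨Q, hQ0, hQ⟩ := hq.exists_pos
  obtain ⟨C₁, hC₁0, hC₁⟩ := hp.1.exists_pos
  obtain ⟨A, hA0, hA⟩ := hp.2.exists_pos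
  obtain ⟨q₀, hq₀, hq₀1, hqq⟩ : ∃ q₀ : ℝ, 0 < q₀ ∧ q₀ ≤ 1 ∧ ∀ᶠ n in atTop, q₀ ≤ q n := by
    refine ⟨min (1 / Q) 1, by positivity, min_le_right _ _, ?_⟩
    filter_upwards [hQ.bound] with n hn
    rw [norm_one, Real.norm_of_nonneg (hq01 n).1] at hn
    refine (min_le_left _ _).trans ?_
    rwa [div_le_iff₀' hQ0]
  -- dividing by `q₀` makes `C / n` an upper bound for `p / (p + q)` as well as for `p`
  set C := C₁ / q₀ with hC
  have hC0 : 0 < C := by positivity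
  have hM : 0 ≤ typicalBound C q₀ := by
    have := driftConst_nonneg hC0.le hq₀
    unfold typicalBound; positivity
  obtain ⟨δ, hδ, c, hc, N, hN⟩ := exists_tvDist_ge_one_step hq₀ hC0.le
    (by positivity : 0 < 1 / A) hM
  have hpq : ∀ᶠ n : ℕ in atTop, p n / q₀ * n ≤ C := by
    filter_upwards [hC₁.bound, eventually_gt_atTop 0] with n hn hn0
    have hn0' : (0 : ℝ) < n := by exact_mod_cast hn0
    rw [Real.norm_of_nonneg (hp01 n).1, Real.norm_of_nonneg (by positivity),
      mul_one_div, le_div_iff₀ hn0'] at hn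
    rw [hC, div_mul_eq_mul_div]
    gcongr
  have hS : ∀ᶠ n : ℕ in atTop, SparseFast q₀ C δ c n (p n) (q n) := by
    filter_upwards [hqq, hpq, hA.bound, eventually_ge_atTop N, eventually_gt_atTop 0] with
      n h1 h2 h3 h4 h5
    have hn0' : (0 : ℝ) < n := by exact_mod_cast h5
    have h6 : p n * n ≤ C := by
      refine le_trans ?_ h2
      gcongr
      rw [le_div_iff₀ hq₀]
      nlinarith [(hp01 n).1]
    have h7 : 1 / A ≤ p n * n := by
      rw [Real.norm_of_nonneg (hp01 n).1, Real.norm_of_nonneg (by positivity),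
        div_le_iff₀ hn0'] at h3
      rw [div_le_iff₀ hA0]
      linarith
    exact ⟨hp01 n, hq01 n, h5, hq₀, h1, h6, hc,
      fun g hg μ hμ hμ1 => hN n h4 _ _ (hp01 n) (hq01 n) h1 h6 h7 g hg μ hμ hμ1⟩
  -- the probability of being mixed through a window beats every polynomial
  have hwin : ∀ ε : ℕ → ℝ, Tendsto ε atTop (𝓝 0) → ∀ k : ℕ, ∀ᶠ n : ℕ in atTop, ∀ t : ℕ,
      ((n : ℝ) ^ k + 1) * (P n).real {ω | IsMixedFrom (ε n) (fun s => G n s ω) t} ≤ 1 / 2 := by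
    intro ε hε k
    have hr0 : 0 ≤ 1 - c / 2 := by linarith [hc.2]
    have hr1 : 1 - c / 2 < 1 := by linarith [hc.1]
    filter_upwards [hS, hε.eventually_lt_const hδ,
      eventually_pow_mul_pow_le (by linarith : 0 ≤ 1 - q₀) (by linarith) one_pos 2,
      eventually_pow_mul_pow_le hr0 hr1 (by norm_num : (0 : ℝ) < 1 / 4) k,
      eventually_pow_mul_pow_le hr0 hr1 (by norm_num : (0 : ℝ) < 1 / 4) 0,
      eventually_ge_atTop 1] with n h1 h2 h3 h4 h5 h6 t
    set l := Nat.sqrt (Nat.sqrt n) - 1 with hl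
    have hl1 : l + 1 = Nat.sqrt (Nat.sqrt n) := by
      have : 1 ≤ Nat.sqrt (Nat.sqrt n) := Nat.le_sqrt.2 (Nat.le_sqrt.2 (by simpa using h6))
      omega
    have h7 : (((l + 1) * (l + 1) : ℕ) : ℝ) ≤ Real.sqrt n := by
      rw [hl1]
      refine le_trans ?_ (Real.nat_sqrt_le_real_sqrt)
      exact_mod_cast Nat.sqrt_le (Nat.sqrt n)
    have h8 := h1.prob_isMixedFrom_le (hG n) h2 t h3 h7
    have h9 : (1 - c / 2) ^ (l + 1) ≤ (1 - c / 2) ^ l :=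
      pow_le_pow_of_le_one hr0 hr1.le (Nat.le_succ l)
    calc _ ≤ ((n : ℝ) ^ k + 1) * (1 - c / 2) ^ l := by gcongr; exact h8.trans h9
      _ = (n : ℝ) ^ k * (1 - c / 2) ^ l + (n : ℝ) ^ 0 * (1 - c / 2) ^ l := by ring
      _ ≤ 1 / 2 := by linarith
  refine ⟨?_, ?_, ?_⟩
  · intro ε η hε hη
    filter_upwards [hwin ε hε 0, hη.eventually_lt_const (by norm_num : (0 : ℝ) < 1 / 2)] with
      n h1 h2
    unfold modelMixingTime
    simp only [iInf_eq_top]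
    intro t ht
    have h3 := h1 t
    rw [pow_zero] at h3
    linarith
  · intro ε η hε hη k
    filter_upwards [hwin ε hε k, hη.eventually_lt_const (by norm_num : (0 : ℝ) < 1 / 2)] with
      n h1 h2
    by_contra hcon
    rw [not_lt] at hcon
    obtain ⟨T, hT, hprob⟩ := exists_le_of_iInf_le hcon
    have h3 : {ω | seqMixingTime (ε n) (fun s => G n s ω) ≤ (T : ℕ∞)} ⊆
        ⋃ t ∈ Finset.range (n ^ k + 1), {ω | IsMixedFrom (ε n) (fun s => G n s ω) t} := by
      intro ω hω
      obtain ⟨t, ht, hmix⟩ := exists_le_of_iInf_le hω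
      simp only [Set.mem_iUnion]
      exact ⟨t, Finset.mem_range.2 (by omega), hmix⟩
    have h4 := (measureReal_mono (μ := P n) h3 (measure_ne_top _ _)).trans (measureReal_biUnion_finset_le _ _)
    have h5 : ((n : ℝ) ^ k + 1) * ∑ t ∈ Finset.range (n ^ k + 1),
        (P n).real {ω | IsMixedFrom (ε n) (fun s => G n s ω) t} ≤ ((n : ℝ) ^ k + 1) * (1 / 2) := by
      rw [Finset.mul_sum]
      refine (Finset.sum_le_sum fun t _ => h1 t).trans (le_of_eq ?_)
      rw [Finset.sum_const, Finset.card_range, nsmul_eq_mul]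
      push_cast
      ring
    have h6 := le_of_mul_le_mul_left h5 (by positivity)
    linarith
  · intro hlaw
    refine ⟨min δ (1 / 4), by positivity, c / 2, by linarith [hc.1], ?_⟩
    filter_upwards [hS, hpq] with n h1 h2 t x
    cases t with
    | zero =>
      have h3 : {ω | min δ (1 / 4) ≤ tvDist (walkDist (fun s => G n s ω) x 0)
          (statDist (G n 0 ω))} = Set.univ :=
        Set.eq_univ_of_forall fun ω =>
          (min_le_right _ _).trans (quarter_le_tvDist_zero (fun s => G n s ω) x)
      rw [h3, probReal_univ]
      linarith [hc.2]
    | succ t =>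
      have h3 := integral_degSq_le_of_hasLaw (C := C) (hp01 n).1 hq₀ h1.hqq h1.hq.2
        (by rwa [Fintype.card_fin]) (hlaw n)
      rw [Fintype.card_fin] at h3
      refine (h1.prob_far_succ_ge (hG n) h3 x t).trans (measureReal_mono ?_)
      intro ω hω
      exact le_trans (min_le_left _ _) (Set.mem_ofPred.1 hω)
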